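/- **Conventions.** All logarithms have base $2$ and all local Hilbert spaces are finite-dimensional. For an $N$-partite state $\rho$ let $\mathrm{SEP}$ be the set of fully separable states (convex combinations of product states $\sigma^1\otimes\cdots\otimes\sigma^N$), and let - $G(\rho)=-2\log\Lambda(\rho)$ with $\Lambda^2(\rho)=\max_{\sigma\in\mathrm{SEP}}\operatorname{tr}(\rho\sigma)$ (geometric measure, GM); - $E_{\mathrm R}(\rho)=\min_{\sigma\in\mathrm{SEP}}S(\rho\|\sigma)$ with $S(\rho\|\sigma)=\operatorname{tr}\rho(\log\rho-\log\sigma)$, which is $+\infty$ unless $\operatorname{supp}\rho\subseteq\operatorname{supp}\sigma$ (relative entropy of entanglement, REE); - $R_{\mathrm L}(\rho)=\log(1+R_{\mathrm g}(\rho))$ with $R_{\mathrm g}(\rho)=\min\{t\ge 0:\ \exists\text{ a state }\Delta,\ \tfrac{\rho+t\Delta}{1+t}\in\mathrm{SEP}\}$ (logarithmic global robustness, LGR). A tensor product of $N$-partite states is again regarded as $N$-partite, the $l$-th party holding the $l$-th subsystem of every factor. For $E\in\{G,E_{\mathrm R},R_{\mathrm L}\}$ put $E^\infty(\rho)=\lim_{n\to\infty}\frac1nE(\rho^{\otimes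 n})$. We say that $E$ of $\rho$ is *additive* if $E^\infty(\rho)=E(\rho)$ (the limit existing), and *strong additive* if $E(\rho\otimes\sigma)=E(\rho)+E(\sigma)$ for every $N$-partite state $\sigma$ (of arbitrary local dimensions). For $N\ge 1$ and $\vec k=(k_0,\dots,k_{d-1})$ with non-negative integers $k_j$ and $\sum_j k_j=N$, the generalized Dicke state $|N,\vec k\rangle\in(\mathbb C^d)^{\otimes N}$ is $$|N,\vec k\rangle=\Bigl(\tfrac{N!}{\prod_j k_j!}\Bigr)^{-1/2}\sum_{x}|x_1\cdots x_N\rangle ,$$ where $x$ runs over all distinct words in which each symbol $j$ occurs exactly $k_j$ times. Put ($0^0=1$, $0\log 0=0$) $$v(N,\vec k)=-\log\Bigl[\frac{N!}{\prod_j k_j!}\prod_j\Bigl(\frac{k_j}{N}\Bigr)^{k_j}\Bigr],\qquad H\Bigl(\frac{\vec k}{N}\Bigr)=-\sum_j\frac{k_j}{N}\log\frac{k_j}{N}.$$ **Proposition.** GM of $|N,\vec k\rangle$ is strong additive, REE and LGR of $|N,\vec k\rangle$ are additive, and $$R_{\mathrm L}^\infty(|N,\vec k\rangle)=E_{\mathrm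 R}^\infty(|N,\vec k\rangle)=G^\infty(|N,\vec k\rangle)=v(N,\vec k).$$ Moreover, if $\widetilde\rho_{N,\vec k}$ is an $(N-1)$-partite reduced state of $|N,\vec k\rangle$, obtained by tracing out any one of the parties, then REE of $\widetilde\rho_{N,\vec k}$ is additive and $$E_{\mathrm R}^\infty(\widetilde\rho_{N,\vec k})=E_{\mathrm R}(\widetilde\rho_{N,\vec k})=v(N,\vec k)-H\Bigl(\frac{\vec k}{N}\Bigr).$$ -/

import Mathlib

noncomputable section

namespace MultipartiteEntanglement

open scoped Matrix Nat Topology ComplexOrder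
open Filter

/-- A quantum state (density matrix) on the finite-dimensional Hilbert space `ℂⁿ`. -/
def IsState {n : Type} [Fintype n] (ρ : Matrix n n ℂ) : Prop :=
  ρ.PosSemidef ∧ ρ.trace = 1

/-- Operators on `⨂_{l ∈ P} ℂ^{ι l}`, written as matrices in the computational (product) basis.
`P` is the finite set of parties and `ι l` labels the basis of the local space of party `l`. -/
abbrev Op {P : Type} (ι : P → Type) : Type :=
  Matrix (∀ l, ι l) (∀ l, ι l) ℂ

section Separable

variable {P : Type} [Fintype P] [DecidableEq P]
variable {ι : P → Type} [∀ l, Fintype (ι l)] [∀ l, DecidableEq (ι l)]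

/-- The product operator `⨂_{l} A l`. -/
def productOp (A : ∀ l, Matrix (ι l) (ι l) ℂ) : Op ι :=
  fun x y => ∏ l, A l (x l) (y l)

variable (ι) in
/-- The fully separable states: convex combinations of product states. -/
def SEP : Set (Op ι) :=
  convexHull ℝ {σ | ∃ A : ∀ l, Matrix (ι l) (ι l) ℂ, (∀ l, IsState (A l)) ∧ σ = productOp A}

/-- The maximal overlap `Λ(ρ)`, where `Λ²(ρ) = max_{σ ∈ SEP} tr(ρσ)`. -/
def maxOverlap (ρ : Op ι) : ℝ :=
  √(sSup {r : ℝ | ∃ σ ∈ SEP ι, r = (ρ * σ).trace.re})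

end Separable

/-- The quantum relative entropy `S(ρ‖σ) = tr ρ (log₂ ρ - log₂ σ)`, which is `+∞` unless the
support of `ρ` is contained in that of `σ`, that is, unless `ker σ ⊆ ker ρ`.
The functional calculus uses `log₂ 0 = 0`, so that each logarithm is taken on the support. -/
def relativeEntropy {n : Type} [Fintype n] [DecidableEq n] (ρ σ : Matrix n n ℂ) : EReal :=
  open Classical in
  if ∀ v : n → ℂ, σ *ᵥ v = 0 → ρ *ᵥ v = 0 then
    (((ρ * (cfc (Real.logb 2) ρ - cfc (Real.logb 2) σ)).trace.re : ℝ) : EReal)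
  else ⊤

/-- The geometric measure `G(ρ) = -2 log₂ Λ(ρ)`. -/
def GM {P : Type} [Fintype P] [DecidableEq P]
    (ι : P → Type) [∀ l, Fintype (ι l)] [∀ l, DecidableEq (ι l)] (ρ : Op ι) : ℝ :=
  -2 * Real.logb 2 (maxOverlap ρ)

/-- The relative entropy of entanglement `E_R(ρ) = min_{σ ∈ SEP} S(ρ‖σ)`. -/
def REE {P : Type} [Fintype P] [DecidableEq P]
    (ι : P → Type) [∀ l, Fintype (ι l)] [∀ l, DecidableEq (ι l)] (ρ : Op ι) : EReal :=
  ⨅ σ ∈ SEP ι, relativeEntropy ρ σ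

/-- The global robustness
`R_g(ρ) = min {t ≥ 0 | ∃ a state Δ with (ρ + tΔ) / (1 + t) ∈ SEP}`. -/
def globalRobustness {P : Type} [Fintype P] [DecidableEq P]
    (ι : P → Type) [∀ l, Fintype (ι l)] [∀ l, DecidableEq (ι l)] (ρ : Op ι) : ℝ :=
  sInf {t : ℝ | 0 ≤ t ∧ ∃ Δ : Op ι, IsState Δ ∧ (1 + t)⁻¹ • (ρ + t • Δ) ∈ SEP ι}

/-- The logarithmic global robustness `R_L(ρ) = log₂ (1 + R_g(ρ))`. -/
def LGR {P : Type} [Fintype P] [DecidableEq P]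
    (ι : P → Type) [∀ l, Fintype (ι l)] [∀ l, DecidableEq (ι l)] (ρ : Op ι) : ℝ :=
  Real.logb 2 (1 + globalRobustness ι ρ)

/-- `ρ ⊗ σ` as a state over the same parties: party `l` holds both of its subsystems. -/
def tensor {P : Type} {ι κ : P → Type} (ρ : Op ι) (σ : Op κ) : Op (fun l => ι l × κ l) :=
  fun x y => ρ (fun l => (x l).1) (fun l => (y l).1) * σ (fun l => (x l).2) (fun l => (y l).2)

/-- `ρ^{⊗n}` as a state over the same parties: party `l` holds its subsystem of every copy. -/
def copies {P : Type} {ι : P → Type} (ρ : Op ι) (n : ℕ) : Op (fun l => Fin n → ι l) :=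
  fun x y => ∏ m : Fin n, ρ (fun l => x l m) (fun l => y l m)

section Additivity

variable {P : Type} [Fintype P] [DecidableEq P] {V : Type}
variable (E : ∀ (κ : P → Type) [∀ l, Fintype (κ l)] [∀ l, DecidableEq (κ l)], Op κ → V)
variable {ι : P → Type} [∀ l, Fintype (ι l)] [∀ l, DecidableEq (ι l)]

/-- `E^∞(ρ) = L`: the limit `lim_{n → ∞} E(ρ^{⊗n}) / n` exists and equals `L`. -/
def HasAsymptotic [Div V] [NatCast V] [TopologicalSpace V] (ρ : Op ι) (L : V) : Prop :=
  Tendsto (fun n : ℕ => E (fun l => Fin n → ι l) (copies ρ n) / (n : V)) atTop (𝓝 L)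

/-- `E` of `ρ` is additive: `E^∞(ρ) = E(ρ)`. -/
def IsAdditive [Div V] [NatCast V] [TopologicalSpace V] (ρ : Op ι) : Prop :=
  HasAsymptotic E ρ (E ι ρ)

/-- `E` of `ρ` is strong additive: `E(ρ ⊗ σ) = E(ρ) + E(σ)` for every state `σ` over the same
parties, with arbitrary finite local dimensions. -/
def IsStrongAdditive [Add V] (ρ : Op ι) : Prop :=
  ∀ (κ : P → Type) [∀ l, Fintype (κ l)] [∀ l, DecidableEq (κ l)] (σ : Op κ), IsState σ →
    E (fun l => ι l × κ l) (tensor ρ σ) = E ι ρ + E κ σ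

end Additivity

/-- The state of the remaining parties after tracing out party `i`. -/
def reduced {P : Type} [DecidableEq P] {ι : P → Type} [∀ l, Fintype (ι l)] (i : P) (ρ : Op ι) :
    Op (fun l : {l : P // l ≠ i} => ι l) :=
  fun x y => ∑ a : ι i, ρ ((Equiv.piSplitAt i ι).symm (a, x)) ((Equiv.piSplitAt i ι).symm (a, y))

/-- The vector `|N, k⟩` in `(ℂ^d)^{⊗N}`: the sum of all basis vectors `|x₁ … x_N⟩` that are
rearrangements of the word in which every symbol `j` occurs `k j` times, divided by the square root
of `N! / ∏ⱼ (k j)!`. -/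
def dickeVec (N : ℕ) {d : ℕ} (k : Fin d → ℕ) (x : Fin N → Fin d) : ℂ :=
  if ∀ j, (Finset.univ.filter fun l => x l = j).card = k j then
    ((1 / √((N ! : ℝ) / ∏ j, ((k j)! : ℝ)) : ℝ) : ℂ)
  else 0

/-- The generalized Dicke state, as the density matrix `|N, k⟩⟨N, k|`. -/
def dicke (N : ℕ) {d : ℕ} (k : Fin d → ℕ) : Op (fun _ : Fin N => Fin d) :=
  Matrix.vecMulVec (dickeVec N k) (star (dickeVec N k))

/-- `-log₂ [ (N! / ∏ⱼ (k j)!) ∏ⱼ (k j / N)^(k j) ]`. -/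
def dickeValue (N : ℕ) {d : ℕ} (k : Fin d → ℕ) : ℝ :=
  -Real.logb 2 ((N ! : ℝ) / (∏ j, ((k j)! : ℝ)) * ∏ j, ((k j : ℝ) / (N : ℝ)) ^ k j)

/-- The Shannon entropy (in bits) of a probability vector. -/
def shannonEntropy {d : ℕ} (p : Fin d → ℝ) : ℝ :=
  -∑ j, p j * Real.logb 2 (p j)

end MultipartiteEntanglement

end

open MultipartiteEntanglement

/-! The maximal overlap of the Dicke state with product states is `c = M * ∏ j, (k j / N) ^ k j`,
where `M` is the number of words of type `k`; thus `-log c = v`. All three measures follow from one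
certificate (`OverlapCertificate`): an entrywise non-negative state `ρ`, the bound `c` on its
overlap with product vectors, and a fully separable `σ` with `σ * ρ = c • ρ`. Here `σ` is the
product state with frequencies `k j / N`, averaged over diagonal phases.

A certificate gives `Λ² = c`. It gives `E_R = tr ρ log ρ - log c`: the value is reached at `σ`, and
concavity of the logarithm shows that no separable state does better. If `ρ` is a projector it also
gives `R_L = -log c`. Certificates pass to `n` copies with `c ^ n`, because non-negative entries
make the overlap multiplicative (`ProductBound.tensor`). This yields additivity, and strong
additivity of GM against an arbitrary second state.

The overlap bound itself is Banach's theorem on symmetric multilinear forms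
(`le_of_forall_diagonal_le`): all local vectors may be taken equal, and then weighted AM-GM
identifies the best one. Tracing out a party leaves a mixture of orthogonal Dicke states with
weights `k s / N`, which has a certificate with the same `c`; its entropy accounts for the term `H`.
-/

noncomputable section

namespace MultipartiteEntanglement

open scoped Matrix Nat Topology ComplexOrder
open Filter

/-! ### Positive semidefinite matrices and their functional calculus. -/

section LinearAlgebra

variable {n : Type} [Fintype n]

theorem trace_mul_vecMulVec (ρ : Matrix n n ℂ) (v : n → ℂ) :
    (ρ * Matrix.vecMulVec v (star v)).trace = star v ⬝ᵥ ρ *ᵥ v := by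
  rw [Matrix.mul_vecMulVec, Matrix.trace_vecMulVec, dotProduct_comm]

theorem trace_mul_re_nonneg {ρ σ : Matrix n n ℂ} (hρ : ρ.PosSemidef) (hσ : σ.PosSemidef) :
    0 ≤ (ρ * σ).trace.re := by
  obtain ⟨m, w, rfl⟩ := Matrix.posSemidef_iff_eq_sum_vecMulVec.mp hσ
  rw [Matrix.mul_sum, Matrix.trace_sum, Complex.re_sum]
  refine Finset.sum_nonneg fun i _ => ?_
  rw [trace_mul_vecMulVec]
  exact (Complex.le_def.mp (hρ.dotProduct_mulVec_nonneg _)).1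

/-- The Cauchy–Schwarz inequality for the sesquilinear form of a positive semidefinite matrix. -/
theorem norm_dotProduct_mulVec_sq_le {σ : Matrix n n ℂ} (hσ : σ.PosSemidef) (u v : n → ℂ) :
    ‖star u ⬝ᵥ σ *ᵥ v‖ ^ 2 ≤ (star u ⬝ᵥ σ *ᵥ u).re * (star v ⬝ᵥ σ *ᵥ v).re := by
  obtain ⟨m, w, rfl⟩ := Matrix.posSemidef_iff_eq_sum_vecMulVec.mp hσ
  have key : ∀ u v : n → ℂ, star u ⬝ᵥ (∑ i, Matrix.vecMulVec (w i) (star (w i))) *ᵥ v =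
      ∑ i, star (star (w i) ⬝ᵥ u) * (star (w i) ⬝ᵥ v) := by
    intro u v
    rw [Matrix.sum_mulVec, dotProduct_sum]
    refine Finset.sum_congr rfl fun i _ => ?_
    rw [Matrix.vecMulVec_mulVec, op_smul_eq_smul, dotProduct_smul, smul_eq_mul, mul_comm,
      Matrix.star_dotProduct]
  have diag : ∀ u : n → ℂ, (star u ⬝ᵥ (∑ i, Matrix.vecMulVec (w i) (star (w i))) *ᵥ u).re =
      ∑ i, ‖star (w i) ⬝ᵥ u‖ ^ 2 := by
    intro u
    rw [key, Complex.re_sum]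
    refine Finset.sum_congr rfl fun i _ => ?_
    rw [Complex.star_def, Complex.conj_mul', ← Complex.ofReal_pow, Complex.ofReal_re]
  rw [diag, diag, key]
  refine le_trans ?_ (Finset.sum_mul_sq_le_sq_mul_sq _ _ _)
  gcongr
  refine (norm_sum_le _ _).trans (Finset.sum_le_sum fun i _ => ?_)
  rw [norm_mul, norm_star]

/-- Splitting both matrices into rank-one terms reduces this to Cauchy–Schwarz for the standard
form. It bounds the overlaps of an arbitrary state, so that their supremum is meaningful. -/
theorem trace_mul_re_le {ρ σ : Matrix n n ℂ} (hρ : ρ.PosSemidef) (hσ : σ.PosSemidef) :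
    (ρ * σ).trace.re ≤ ρ.trace.re * σ.trace.re := by
  classical
  obtain ⟨k, v, rfl⟩ := Matrix.posSemidef_iff_eq_sum_vecMulVec.mp hρ
  obtain ⟨m, w, rfl⟩ := Matrix.posSemidef_iff_eq_sum_vecMulVec.mp hσ
  simp only [Matrix.trace_sum, Complex.re_sum, Finset.sum_mul_sum]
  refine Finset.sum_le_sum fun i _ => Finset.sum_le_sum fun j _ => ?_
  have h := norm_dotProduct_mulVec_sq_le (Matrix.PosSemidef.one (n := n) (R := ℂ)) (v i) (w j)
  rw [Matrix.one_mulVec, Matrix.one_mulVec] at h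
  rw [Matrix.trace_vecMulVec, Matrix.trace_vecMulVec, trace_mul_vecMulVec,
    dotProduct_comm (v i), dotProduct_comm (w j)]
  refine le_trans (le_of_eq ?_) h
  rw [Matrix.vecMulVec_mulVec, op_smul_eq_smul, dotProduct_smul, smul_eq_mul,
    Matrix.star_dotProduct, Complex.star_def, Complex.conj_mul', ← Complex.ofReal_pow,
    Complex.ofReal_re, RCLike.norm_conj]

variable [DecidableEq n]

/-- The columns of `B` lie in the `c`-eigenspace of `A`: in an eigenbasis of `A`, a row of `B` can
be non-zero only where the eigenvalue is `c`. -/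
theorem cfc_mul_of_mul_eq_smul {A B : Matrix n n ℂ} (hA : A.IsHermitian) {c : ℝ}
    (h : A * B = c • B) (f : ℝ → ℝ) : cfc f A * B = f c • B := by
  set U : Matrix n n ℂ := (hA.eigenvectorUnitary : Matrix n n ℂ) with hU
  have hUU : star U * U = 1 := Unitary.coe_star_mul_self hA.eigenvectorUnitary
  have hUU' : U * star U = 1 := Unitary.coe_mul_star_self hA.eigenvectorUnitary
  have hcfc : ∀ g : ℝ → ℝ, hA.cfc g =
      U * Matrix.diagonal (RCLike.ofReal ∘ g ∘ hA.eigenvalues) * star U := fun g => by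
    rw [Matrix.IsHermitian.cfc, Unitary.conjStarAlgAut_apply]
  have hAd : A = U * Matrix.diagonal (RCLike.ofReal ∘ hA.eigenvalues) * star U := by
    conv_lhs => rw [hA.spectral_theorem, Unitary.conjStarAlgAut_apply]
  have h1 : Matrix.diagonal (RCLike.ofReal ∘ hA.eigenvalues) * (star U * B) = c • (star U * B) := by
    rw [← Matrix.mul_smul, ← h]
    conv_rhs => rw [hAd]
    simp only [← mul_assoc, hUU, one_mul]
  have h2 : Matrix.diagonal (RCLike.ofReal ∘ f ∘ hA.eigenvalues) * (star U * B)
      = f c • (star U * B) := by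
    ext i j
    have := congrFun (congrFun h1 i) j
    simp only [Matrix.diagonal_mul, Matrix.smul_apply, Function.comp_apply] at this ⊢
    rcases eq_or_ne ((star U * B) i j) 0 with h0 | h0
    · simp [h0]
    · rw [Complex.real_smul] at this ⊢
      have h3 : hA.eigenvalues i = c :=
        Complex.ofReal_injective (mul_right_cancel₀ h0 this)
      rw [h3]; rfl
  rw [hA.cfc_eq, hcfc, mul_assoc, mul_assoc, h2, Matrix.mul_smul, ← mul_assoc, hUU', one_mul]

/-- The distribution of the spectrum of `σ` in the state `ρ`. -/
theorem exists_spectral_distribution {ρ σ : Matrix n n ℂ} (hρ : IsState ρ) (hσ : σ.IsHermitian)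
    (hker : ∀ v : n → ℂ, σ *ᵥ v = 0 → ρ *ᵥ v = 0) :
    ∃ p : n → ℝ, (∀ i, 0 ≤ p i) ∧ ∑ i, p i = 1 ∧ (∀ i, hσ.eigenvalues i = 0 → p i = 0) ∧
      ∀ f : ℝ → ℝ, (ρ * cfc f σ).trace.re = ∑ i, p i * f (hσ.eigenvalues i) := by
  set U : Matrix n n ℂ := (hσ.eigenvectorUnitary : Matrix n n ℂ) with hU
  have hUU : star U * U = 1 := Unitary.coe_star_mul_self hσ.eigenvectorUnitary
  have hUU' : U * star U = 1 := Unitary.coe_mul_star_self hσ.eigenvectorUnitary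
  have hps : (star U * ρ * U).PosSemidef := hρ.1.conjTranspose_mul_mul_same U
  have hf : ∀ f : ℝ → ℝ, (ρ * cfc f σ).trace.re =
      ∑ i, ((star U * ρ * U) i i).re * f (hσ.eigenvalues i) := by
    intro f
    rw [hσ.cfc_eq, Matrix.IsHermitian.cfc, Unitary.conjStarAlgAut_apply, ← mul_assoc, ← mul_assoc,
      Matrix.trace_mul_comm, ← mul_assoc, ← mul_assoc, Matrix.trace, Complex.re_sum]
    refine Finset.sum_congr rfl fun i _ => ?_
    rw [Matrix.diag_apply, Matrix.mul_diagonal]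
    simp only [Function.comp_apply]
    exact Complex.re_mul_ofReal _ _
  refine ⟨fun i => ((star U * ρ * U) i i).re, fun i => ?_, ?_, fun i hi => ?_, hf⟩
  · exact (Complex.le_def.mp (hps.diag_nonneg (i := i))).1
  · have : (star U * ρ * U).trace = 1 := by
      rw [Matrix.trace_mul_comm, ← mul_assoc, hUU', one_mul, hρ.2]
    have := congrArg Complex.re this
    rwa [Matrix.trace, Complex.re_sum, Complex.one_re] at this
  -- An eigenvector of `σ` with eigenvalue zero is killed by `ρ`, so the convention `log 0 = 0`
  -- never contributes.
  · have h0 : ρ *ᵥ (U.col i) = 0 := by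
      apply hker
      have := hσ.mulVec_eigenvectorBasis i
      rw [hi, zero_smul] at this
      exact this
    have h1 : ∀ j, (ρ * U) j i = 0 := fun j => congrFun h0 j
    show ((star U * ρ * U) i i).re = 0
    rw [mul_assoc, Matrix.mul_apply]
    simp [h1]

/-- Jensen's inequality for the spectral distribution of `σ` in `ρ`, using the tangent line `log x ≤
x / c - 1 + log c` of the logarithm at `c`. -/
theorem trace_mul_cfc_logb_le {ρ σ : Matrix n n ℂ} (hρ : IsState ρ) (hσ : σ.PosSemidef)
    (hker : ∀ v : n → ℂ, σ *ᵥ v = 0 → ρ *ᵥ v = 0) {c : ℝ} (hc : 0 < c)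
    (h : (ρ * σ).trace.re ≤ c) : (ρ * cfc (Real.logb 2) σ).trace.re ≤ Real.logb 2 c := by
  obtain ⟨p, hp, hp1, hp0, hf⟩ := exists_spectral_distribution hρ hσ.isHermitian hker
  have hid := hf id
  rw [show cfc (id : ℝ → ℝ) σ = σ from cfc_id ℝ σ hσ.isHermitian.isSelfAdjoint] at hid
  rw [hid] at h
  rw [hf]
  have hlog2 : 0 < Real.log 2 := Real.log_pos one_lt_two
  simp only [Real.logb, mul_div_assoc', id] at h ⊢
  rw [← Finset.sum_div]
  gcongr
  calc ∑ i, p i * Real.log (hσ.isHermitian.eigenvalues i)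
      ≤ ∑ i, p i * (hσ.isHermitian.eigenvalues i / c - 1 + Real.log c) := by
        refine Finset.sum_le_sum fun i _ => ?_
        rcases (hσ.eigenvalues_nonneg i).eq_or_lt with h0 | h0
        · simp [hp0 i h0.symm]
        · refine mul_le_mul_of_nonneg_left ?_ (hp i)
          have := Real.log_le_sub_one_of_pos (div_pos h0 hc)
          rw [Real.log_div h0.ne' hc.ne'] at this
          linarith
    _ = (∑ i, p i * hσ.isHermitian.eigenvalues i) / c - ∑ i, p i + (∑ i, p i) * Real.log c := by
        rw [Finset.sum_div, Finset.sum_mul, ← Finset.sum_sub_distrib, ← Finset.sum_add_distrib]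
        exact Finset.sum_congr rfl fun i _ => by ring
    _ ≤ Real.log c := by
        rw [hp1]
        have := (div_le_one hc).mpr h
        linarith

end LinearAlgebra

/-! ### Product vectors, separable states and overlap bounds. -/

section ProductVectors

variable {P : Type} [Fintype P]
variable {ι : P → Type}

/-- The product vector `⨂_{l} a l`. -/
def prodVec (a : ∀ l, ι l → ℂ) : (∀ l, ι l) → ℂ := fun x => ∏ l, a l (x l)

theorem productOp_vecMulVec (a : ∀ l, ι l → ℂ) :
    productOp (fun l => Matrix.vecMulVec (a l) (star (a l))) =
      Matrix.vecMulVec (prodVec a) (star (prodVec a)) := by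
  ext x y
  simp [productOp, prodVec, Matrix.vecMulVec_apply, Finset.prod_mul_distrib]

theorem productOp_smul (r : P → ℝ) (A : ∀ l, Matrix (ι l) (ι l) ℂ) :
    productOp (fun l => r l • A l) = (∏ l, r l) • productOp A := by
  ext x y
  simp [productOp, Finset.prod_mul_distrib]

variable [DecidableEq P]

theorem productOp_sum {κ : P → Type} [∀ l, Fintype (κ l)]
    (A : ∀ l, κ l → Matrix (ι l) (ι l) ℂ) :
    productOp (fun l => ∑ i, A l i) = ∑ i : ∀ l, κ l, productOp fun l => A l (i l) := by
  ext x y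
  simp only [productOp, Matrix.sum_apply]
  exact Fintype.prod_sum fun l i => A l i (x l) (y l)

variable [∀ l, Fintype (ι l)]

theorem trace_productOp (A : ∀ l, Matrix (ι l) (ι l) ℂ) :
    (productOp A).trace = ∏ l, (A l).trace :=
  (Fintype.prod_sum fun l i => A l i i).symm

theorem productOp_posSemidef {A : ∀ l, Matrix (ι l) (ι l) ℂ} (hA : ∀ l, (A l).PosSemidef) :
    (productOp A).PosSemidef := by
  choose m w hw using fun l => Matrix.posSemidef_iff_eq_sum_vecMulVec.mp (hA l)
  obtain rfl : A = fun l => _ := funext hw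
  rw [productOp_sum]
  refine Matrix.posSemidef_sum _ fun i _ => ?_
  rw [productOp_vecMulVec]
  exact Matrix.posSemidef_vecMulVec_self_star _

theorem productOp_isState {A : ∀ l, Matrix (ι l) (ι l) ℂ} (hA : ∀ l, IsState (A l)) :
    IsState (productOp A) :=
  ⟨productOp_posSemidef fun l => (hA l).1, by simp [trace_productOp, (hA _).2]⟩

theorem real_smul_posSemidef {n : Type} {A : Matrix n n ℂ} (hA : A.PosSemidef) {r : ℝ}
    (hr : 0 ≤ r) : (r • A).PosSemidef := by
  have := hA.smul (α := ℂ) (a := (r : ℂ)) (Complex.zero_le_real.mpr hr)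
  rwa [show (r : ℂ) • A = r • A from by ext; simp] at this

theorem convex_isState {n : Type} [Fintype n] : Convex ℝ {ρ : Matrix n n ℂ | IsState ρ} := by
  rintro ρ ⟨h1, h2⟩ σ ⟨h3, h4⟩ a b ha hb hab
  refine ⟨(real_smul_posSemidef h1 ha).add (real_smul_posSemidef h3 hb), ?_⟩
  rw [Matrix.trace_add, Matrix.trace_smul, Matrix.trace_smul, h2, h4]
  rw [← add_smul, hab, one_smul]

theorem isState_of_mem_SEP {σ : Op ι} (hσ : σ ∈ SEP ι) : IsState σ := by
  refine convexHull_min (t := {ρ : Op ι | IsState ρ}) ?_ convex_isState hσ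
  rintro _ ⟨A, hA, rfl⟩
  exact productOp_isState hA

/-- `⟨a|ρ|a⟩ ≤ c ‖a‖²` for all product vectors `a`. -/
def ProductBound (ρ : Op ι) (c : ℝ) : Prop :=
  ∀ a : ∀ l, ι l → ℂ, (star (prodVec a) ⬝ᵥ ρ *ᵥ prodVec a).re ≤ c * ∏ l, ∑ j, ‖a l j‖ ^ 2

/-- A product state is a sum of projections on unnormalised product vectors whose squared norms add
up to 1. Since the bound is homogeneous, no normalisation is needed. -/
theorem ProductBound.trace_le {ρ : Op ι} {c : ℝ} (h : ProductBound ρ c) {σ : Op ι}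
    (hσ : σ ∈ SEP ι) : (ρ * σ).trace.re ≤ c := by
  refine convexHull_min (t := {σ : Op ι | (ρ * σ).trace.re ≤ c}) ?_ ?_ hσ
  · rintro _ ⟨A, hA, rfl⟩
    choose m w hw using fun l => Matrix.posSemidef_iff_eq_sum_vecMulVec.mp (hA l).1
    obtain rfl : A = fun l => _ := funext hw
    have htr : ∀ l, ∑ i, ∑ j, ‖w l i j‖ ^ 2 = 1 := by
      intro l
      have := congrArg Complex.re (hA l).2
      rw [Matrix.trace_sum, Complex.re_sum, Complex.one_re] at this
      rw [← this]
      refine Finset.sum_congr rfl fun i _ => ?_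
      rw [Matrix.trace_vecMulVec, dotProduct, Complex.re_sum]
      refine Finset.sum_congr rfl fun j _ => ?_
      rw [Pi.star_apply, Complex.star_def, Complex.mul_conj', ← Complex.ofReal_pow,
        Complex.ofReal_re]
    rw [Set.mem_ofPred_eq, productOp_sum, Matrix.mul_sum, Matrix.trace_sum, Complex.re_sum]
    calc _ ≤ ∑ i : ∀ l, Fin (m l), c * ∏ l, ∑ j, ‖w l (i l) j‖ ^ 2 := by
          refine Finset.sum_le_sum fun i _ => ?_
          rw [productOp_vecMulVec, trace_mul_vecMulVec]
          exact h _
      _ = c * ∏ l, ∑ i, ∑ j, ‖w l i j‖ ^ 2 := by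
          rw [← Finset.mul_sum, Fintype.prod_sum]
      _ = c := by simp [htr]
  · rintro σ hσ τ hτ a b ha hb hab
    simp only [Set.mem_ofPred_eq] at hσ hτ ⊢
    rw [Matrix.mul_add, Matrix.trace_add, Matrix.mul_smul, Matrix.mul_smul, Matrix.trace_smul,
      Matrix.trace_smul, Complex.add_re, Complex.smul_re, Complex.smul_re]
    calc a • (ρ * σ).trace.re + b • (ρ * τ).trace.re ≤ a • c + b • c := by gcongr
      _ = c := by rw [← add_smul, hab, one_smul]

theorem productBound_of_forall_trace_le {ρ : Op ι} {c : ℝ}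
    (h : ∀ σ ∈ SEP ι, (ρ * σ).trace.re ≤ c) : ProductBound ρ c := by
  intro a
  set r : P → ℝ := fun l => ∑ j, ‖a l j‖ ^ 2 with hr
  change _ ≤ c * ∏ l, r l
  -- If a local vector vanishes, both sides are zero; otherwise every local vector can be normalised
  -- to a state.
  by_cases h0 : ∃ l, r l = 0
  · obtain ⟨l, hl⟩ := h0
    have hal : a l = 0 := by
      rw [hr] at hl
      ext j
      have := (Finset.sum_eq_zero_iff_of_nonneg fun _ _ => by positivity).mp hl j
        (Finset.mem_univ _)
      simpa using this
    have : prodVec a = 0 := by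
      ext x
      exact Finset.prod_eq_zero (Finset.mem_univ l) (by simp [hal])
    rw [this, Finset.prod_eq_zero (Finset.mem_univ l) hl]
    simp
  · push Not at h0
    have hr0 : ∀ l, 0 < r l := fun l =>
      lt_of_le_of_ne (Finset.sum_nonneg fun _ _ => by positivity) (h0 l).symm
    have hmem : productOp (fun l => (r l)⁻¹ • Matrix.vecMulVec (a l) (star (a l))) ∈ SEP ι := by
      refine subset_convexHull ℝ _ ⟨_, fun l => ⟨real_smul_posSemidef
        (Matrix.posSemidef_vecMulVec_self_star _) (inv_nonneg.mpr (hr0 l).le), ?_⟩, rfl⟩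
      have : (a l ⬝ᵥ star (a l)) = (r l : ℂ) := by
        simp [dotProduct, hr, Complex.mul_conj']
      rw [Matrix.trace_smul, Matrix.trace_vecMulVec, this, Complex.real_smul, Complex.ofReal_inv,
        inv_mul_cancel₀]
      exact_mod_cast h0 l
    have := h _ hmem
    rw [productOp_smul, productOp_vecMulVec, Matrix.mul_smul, Matrix.trace_smul,
      trace_mul_vecMulVec, Complex.smul_re, smul_eq_mul, Finset.prod_inv_distrib,
      inv_mul_le_iff₀ (Finset.prod_pos fun l _ => hr0 l)] at this
    rwa [mul_comm]

theorem ProductBound.reindex {κ : P → Type} [∀ l, Fintype (κ l)] {ρ : Op κ} {c : ℝ}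
    (h : ProductBound ρ c) (e : ∀ l, ι l ≃ κ l) :
    ProductBound (fun x y => ρ (fun l => e l (x l)) (fun l => e l (y l)) : Op ι) c := by
  intro a
  have := h fun l j => a l ((e l).symm j)
  have h2 : ∀ l, ∑ j, ‖a l ((e l).symm j)‖ ^ 2 = ∑ j, ‖a l j‖ ^ 2 := fun l =>
    (e l).symm.sum_comp fun j => ‖a l j‖ ^ 2
  simp only [h2] at this
  refine le_trans (le_of_eq ?_) this
  congr 1
  simp only [dotProduct, Matrix.mulVec, Pi.star_apply]
  refine Fintype.sum_equiv (Equiv.piCongrRight e) _ _ fun x => ?_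
  congr 1
  · simp [prodVec]
  · refine Fintype.sum_equiv (Equiv.piCongrRight e) _ _ fun y => ?_
    simp [prodVec]
    exact Or.inl rfl

/-- The maximal overlap with product vectors of a state with non-negative entries is
multiplicative under tensor products. -/
theorem ProductBound.tensor {κ : P → Type} [∀ l, Fintype (κ l)] {ρ : Op ι} {σ : Op κ} {c s : ℝ}
    (hρ : ProductBound ρ c) (hnn : ∀ x y, 0 ≤ ρ x y) (hσ : ProductBound σ s)
    (hpos : σ.PosSemidef) (hs : 0 ≤ s) : ProductBound (tensor ρ σ) (c * s) := by
  intro a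
  -- For each basis word `x` of the first factor, `b x` is the product vector that `a` leaves on the
  -- second factor, and the numbers `t l i` are the local norms of these slices.
  set b : (∀ l, ι l) → ∀ l, κ l → ℂ := fun x l j => a l (x l, j) with hb
  set t : ∀ l, ι l → ℝ := fun l i => √(∑ j, ‖a l (i, j)‖ ^ 2) with ht
  have ht2 : ∀ l i, t l i ^ 2 = ∑ j, ‖a l (i, j)‖ ^ 2 := fun l i =>
    Real.sq_sqrt (Finset.sum_nonneg fun _ _ => by positivity)
  have ht0 : ∀ l i, 0 ≤ t l i := fun l i => Real.sqrt_nonneg _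
  have hpt0 : ∀ x : ∀ l, ι l, 0 ≤ ∏ l, t l (x l) := fun x => Finset.prod_nonneg fun l _ => ht0 _ _
  have hbx : ∀ x, (star (prodVec (b x)) ⬝ᵥ σ *ᵥ prodVec (b x)).re ≤ s * (∏ l, t l (x l)) ^ 2 := by
    intro x
    have := hσ (b x)
    rw [← Finset.prod_pow]
    simpa only [ht2] using this
  -- Positivity of `σ` extends the bound from the diagonal to the off-diagonal terms by
  -- Cauchy–Schwarz.
  have hbxy : ∀ x y, ‖star (prodVec (b x)) ⬝ᵥ σ *ᵥ prodVec (b y)‖ ≤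
      s * ((∏ l, t l (x l)) * ∏ l, t l (y l)) := by
    intro x y
    refine abs_le_of_sq_le_sq' ?_ (by have := hpt0 x; have := hpt0 y; positivity) |>.2
    refine (norm_dotProduct_mulVec_sq_le hpos _ _).trans ?_
    calc _ ≤ (s * (∏ l, t l (x l)) ^ 2) * (s * (∏ l, t l (y l)) ^ 2) := by
          refine mul_le_mul (hbx x) (hbx y) ?_ (by positivity)
          exact (Complex.le_def.mp (hpos.dotProduct_mulVec_nonneg _)).1
      _ = _ := by ring
  have hexp : star (prodVec a) ⬝ᵥ MultipartiteEntanglement.tensor ρ σ *ᵥ prodVec a =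
      ∑ x, ∑ y, ρ x y * (star (prodVec (b x)) ⬝ᵥ σ *ᵥ prodVec (b y)) := by
    simp only [dotProduct, Matrix.mulVec, Pi.star_apply, Finset.mul_sum]
    rw [Fintype.sum_equiv (Equiv.arrowProdEquivProdArrow P ι κ) _
      (fun z => ∑ w : (∀ l, ι l) × (∀ l, κ l), star (prodVec (b z.1) z.2) *
        (ρ z.1 w.1 * σ z.2 w.2 * prodVec (b w.1) w.2))]
    · simp only [Fintype.sum_prod_type]
      refine Finset.sum_congr rfl fun x _ => ?_
      rw [Finset.sum_comm]
      refine Finset.sum_congr rfl fun y _ => Finset.sum_congr rfl fun z _ =>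
        Finset.sum_congr rfl fun w _ => by ring
    · intro x
      refine Fintype.sum_equiv (Equiv.arrowProdEquivProdArrow P ι κ) _ _ fun y => ?_
      rfl
  have hreal : ∀ x y, (‖ρ x y‖ : ℂ) = ρ x y := fun x y => by
    rw [Complex.norm_of_nonneg' (hnn x y)]
  have hq : (star (prodVec fun l i => (t l i : ℂ)) ⬝ᵥ ρ *ᵥ prodVec fun l i => (t l i : ℂ)).re =
      ∑ x, ∑ y, ‖ρ x y‖ * ((∏ l, t l (x l)) * ∏ l, t l (y l)) := by
    simp only [dotProduct, Matrix.mulVec, Pi.star_apply, Finset.mul_sum, Complex.re_sum, prodVec]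
    refine Finset.sum_congr rfl fun x _ => Finset.sum_congr rfl fun y _ => ?_
    rw [← hreal x y, ← Complex.ofReal_prod, ← Complex.ofReal_prod, Complex.star_def,
      Complex.conj_ofReal, ← Complex.ofReal_mul, ← Complex.ofReal_mul, Complex.ofReal_re]
    simp
    ring
  -- As the entries of `ρ` are non-negative, taking absolute values turns the sum into the form of
  -- `ρ` itself at the product vector with local components `t l i`, to which `hρ` applies.
  calc _ ≤ ∑ x, ∑ y, ‖ρ x y‖ * (s * ((∏ l, t l (x l)) * ∏ l, t l (y l))) := by
        rw [hexp]
        refine (Complex.re_le_norm _).trans ((norm_sum_le _ _).trans ?_)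
        refine Finset.sum_le_sum fun x _ => (norm_sum_le _ _).trans ?_
        refine Finset.sum_le_sum fun y _ => ?_
        rw [norm_mul]
        exact mul_le_mul_of_nonneg_left (hbxy x y) (norm_nonneg _)
    _ = s * (star (prodVec fun l i => (t l i : ℂ)) ⬝ᵥ
          ρ *ᵥ prodVec fun l i => (t l i : ℂ)).re := by
        rw [hq]
        simp only [Finset.mul_sum]
        exact Finset.sum_congr rfl fun x _ => Finset.sum_congr rfl fun y _ => by ring
    _ ≤ s * (c * ∏ l, ∑ i, ‖(t l i : ℂ)‖ ^ 2) := mul_le_mul_of_nonneg_left (hρ _) hs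
    _ = c * s * ∏ l, ∑ j, ‖a l j‖ ^ 2 := by
        have : ∀ l, ∑ i, ‖(t l i : ℂ)‖ ^ 2 = ∑ j, ‖a l j‖ ^ 2 := fun l => by
          rw [Fintype.sum_prod_type]
          refine Finset.sum_congr rfl fun i _ => ?_
          rw [← ht2, Complex.norm_real, Real.norm_eq_abs, sq_abs]
        simp only [this]
        ring

end ProductVectors

/-! ### Tensor products of separable states. -/

section Tensor

variable {P : Type} [Fintype P] {ι κ : P → Type} 

theorem isState_kronecker {n m : Type} [Fintype n] [Fintype m] {A : Matrix n n ℂ}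
    {B : Matrix m m ℂ} (hA : IsState A) (hB : IsState B) :
    IsState (Matrix.kroneckerMap (· * ·) A B) :=
  ⟨hA.1.kronecker hB.1, by
    rw [Matrix.trace_kronecker (A := A) (B := B), hA.2, hB.2, one_mul]⟩

variable [∀ l, Fintype (ι l)] [∀ l, Fintype (κ l)]

theorem tensor_mem_SEP {σ : Op ι} {τ : Op κ} (hσ : σ ∈ SEP ι) (hτ : τ ∈ SEP κ) :
    tensor σ τ ∈ SEP (fun l => ι l × κ l) := by
  obtain ⟨Θ, _, w, z, hw, hw1, hz, rfl⟩ := mem_convexHull_iff_exists_fintype.mp hσ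
  obtain ⟨Φ, _, v, y, hv, hv1, hy, rfl⟩ := mem_convexHull_iff_exists_fintype.mp hτ
  choose A hA hzA using hz
  choose B hB hyB using hy
  refine mem_convexHull_iff_exists_fintype.mpr ⟨Θ × Φ, inferInstance, fun i => w i.1 * v i.2,
    fun i => productOp fun l => Matrix.kroneckerMap (· * ·) (A i.1 l) (B i.2 l),
    fun i => mul_nonneg (hw _) (hv _), ?_, fun i => ⟨_, fun l =>
      isState_kronecker (hA _ _) (hB _ _), rfl⟩, ?_⟩
  · rw [Fintype.sum_prod_type, ← Finset.sum_mul_sum, hw1, hv1, one_mul]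
  · ext x x'
    simp only [tensor, Matrix.sum_apply, Matrix.smul_apply, hzA, hyB, Finset.sum_mul_sum,
      Fintype.sum_prod_type]
    refine Finset.sum_congr rfl fun i _ => Finset.sum_congr rfl fun j _ => ?_
    simp only [productOp, Matrix.kroneckerMap_apply, Finset.prod_mul_distrib, Complex.real_smul,
      Complex.ofReal_mul]
    ring

variable [DecidableEq P]

theorem trace_tensor_mul_tensor (ρ σ : Op ι) (ρ' σ' : Op κ) :
    (tensor ρ ρ' * tensor σ σ').trace = (ρ * σ).trace * (ρ' * σ').trace := by
  simp only [Matrix.trace, Matrix.diag_apply, Matrix.mul_apply, Finset.sum_mul_sum]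
  rw [Fintype.sum_equiv (Equiv.arrowProdEquivProdArrow P ι κ) _
    (fun z => ∑ w : (∀ l, ι l) × (∀ l, κ l), (ρ z.1 w.1 * ρ' z.2 w.2) * (σ w.1 z.1 * σ' w.2 z.2))]
  · simp only [Fintype.sum_prod_type]
    refine Finset.sum_congr rfl fun x _ => Finset.sum_congr rfl fun y _ =>
      Finset.sum_congr rfl fun z _ => Finset.sum_congr rfl fun w _ => by ring
  · intro x
    exact Fintype.sum_equiv (Equiv.arrowProdEquivProdArrow P ι κ) _ _ fun y => rfl

end Tensor

/-! ### Tensor powers. -/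

section Copies

variable {P : Type} {ι : P → Type} 

theorem copies_smul (r : ℝ) (ρ : Op ι) (n : ℕ) : copies (r • ρ) n = r ^ n • copies ρ n := by
  ext x y
  simp [copies, Finset.prod_mul_distrib]

/-- Exchanging the roles of party and copy presents a tensor power as a product operator whose
"parties" are the copies. -/
theorem copies_eq_submatrix (ρ : Op ι) (n : ℕ) :
    copies ρ n = (productOp fun _ : Fin n => ρ).submatrix
      (Equiv.piComm fun l (_ : Fin n) => ι l) (Equiv.piComm fun l (_ : Fin n) => ι l) := rfl

variable [Fintype P] [∀ l, Fintype (ι l)]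

theorem copies_mem_SEP {σ : Op ι} (hσ : σ ∈ SEP ι) (n : ℕ) :
    copies σ n ∈ SEP (fun l => Fin n → ι l) := by
  obtain ⟨Θ, _, w, z, hw, hw1, hz, rfl⟩ := mem_convexHull_iff_exists_fintype.mp hσ
  choose A hA hzA using hz
  refine mem_convexHull_iff_exists_fintype.mpr ⟨Fin n → Θ, inferInstance, fun i => ∏ m, w (i m),
    fun i => productOp fun l => productOp fun m => A (i m) l,
    fun i => Finset.prod_nonneg fun _ _ => hw _, ?_,
    fun i => ⟨_, fun l => productOp_isState fun m => hA _ _, rfl⟩, ?_⟩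
  · rw [← Fintype.sum_pow, hw1, one_pow]
  · ext x y
    simp only [copies, Matrix.sum_apply, Matrix.smul_apply, hzA, Fintype.prod_sum]
    refine Finset.sum_congr rfl fun i _ => ?_
    simp only [productOp, Complex.real_smul, Finset.prod_mul_distrib, Complex.ofReal_prod]
    rw [Finset.prod_comm]

variable [DecidableEq P]

theorem sum_prod_copies {R : Type} [CommSemiring R] {n : ℕ} (f : Fin n → (∀ l, ι l) → R) :
    ∑ x : ∀ l, Fin n → ι l, ∏ m, f m (fun l => x l m) = ∏ m, ∑ x, f m x := by
  rw [Fintype.prod_sum]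
  exact Fintype.sum_equiv (Equiv.piComm fun l (_ : Fin n) => ι l) _ _ fun x => rfl

theorem copies_mul_copies (ρ σ : Op ι) (n : ℕ) :
    copies ρ n * copies σ n = copies (ρ * σ) n := by
  ext x y
  simp only [copies, Matrix.mul_apply, ← Finset.prod_mul_distrib]
  exact sum_prod_copies fun m z => ρ (fun l => x l m) z * σ z (fun l => y l m)

theorem trace_copies (ρ : Op ι) (n : ℕ) : (copies ρ n).trace = ρ.trace ^ n := by
  simp only [Matrix.trace, Matrix.diag_apply, copies]
  rw [sum_prod_copies fun _ x => ρ x x]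
  simp

theorem copies_isState {ρ : Op ι} (hρ : IsState ρ) (n : ℕ) : IsState (copies ρ n) := by
  refine ⟨?_, by rw [trace_copies, hρ.2, one_pow]⟩
  rw [copies_eq_submatrix]
  exact (productOp_posSemidef fun _ => hρ.1).submatrix _

theorem ProductBound.copies {ρ : Op ι} {c : ℝ} (hρ : ProductBound ρ c) (hc : 0 ≤ c)
    (hs : IsState ρ) (hnn : ∀ x y, 0 ≤ ρ x y) (n : ℕ) : ProductBound (copies ρ n) (c ^ n) := by
  induction n with
  -- With no copies every local space is one-dimensional, and the bound is an equality.
  | zero =>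
    intro a
    have : ∀ l, ∑ j, ‖a l j‖ ^ 2 = ‖a l default‖ ^ 2 := fun l => by
      rw [Fintype.sum_unique]
    simp only [this, pow_zero, one_mul]
    rw [Finset.prod_pow, ← norm_prod]
    simp only [dotProduct, Matrix.mulVec, Fintype.sum_unique]
    simp only [MultipartiteEntanglement.copies, Finset.univ_eq_empty, Finset.prod_empty, one_mul,
      Pi.star_apply, Complex.star_def, Complex.conj_mul', prodVec]
    rw [← Complex.ofReal_pow, Complex.ofReal_re]
    exact le_of_eq rfl
  | succ n ih =>
    -- The first copy is split off; it is the factor whose entries must be non-negative.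
    have h1 := (hρ.tensor hnn ih (copies_isState hs n).1 (pow_nonneg hc n)).reindex
      fun l => (Fin.consEquiv fun _ : Fin (n + 1) => ι l).symm
    rw [← pow_succ'] at h1
    refine (congrArg (fun σ => ProductBound σ _) ?_).mpr h1
    ext x y
    simp only [MultipartiteEntanglement.copies, Fin.prod_univ_succ]
    rfl

end Copies

/-! ### The three measures computed from an overlap certificate. -/

section Certificate

variable {P : Type} [Fintype P] [DecidableEq P]
variable {ι : P → Type} [∀ l, Fintype (ι l)]

/-- `σ` is a fully separable state closest to the entrywise non-negative state `ρ`: on the range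
of `ρ` it acts as the maximal overlap `c` of `ρ` with product states. -/
structure OverlapCertificate (ρ σ : Op ι) (c : ℝ) : Prop where
  isState : IsState ρ
  entry_nonneg : ∀ x y, 0 ≤ ρ x y
  bound : ProductBound ρ c
  mem_SEP : σ ∈ SEP ι
  mul_eq : σ * ρ = c • ρ
  pos : 0 < c

namespace OverlapCertificate

variable {ρ σ : Op ι} {c : ℝ}

theorem copies (h : OverlapCertificate ρ σ c) (n : ℕ) :
    OverlapCertificate (copies ρ n) (copies σ n) (c ^ n) where
  isState := copies_isState h.isState n
  entry_nonneg x y := Finset.prod_nonneg fun _ _ => h.entry_nonneg _ _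
  bound := h.bound.copies h.pos.le h.isState h.entry_nonneg n
  mem_SEP := copies_mem_SEP h.mem_SEP n
  mul_eq := by rw [copies_mul_copies, h.mul_eq, copies_smul]
  pos := pow_pos h.pos n

theorem mul_eq' (h : OverlapCertificate ρ σ c) : ρ * σ = c • ρ := by
  have := congrArg Matrix.conjTranspose h.mul_eq
  rwa [Matrix.conjTranspose_mul, Matrix.conjTranspose_smul, h.isState.1.isHermitian.eq,
    (isState_of_mem_SEP h.mem_SEP).1.isHermitian.eq, star_trivial] at this

theorem trace_mul (h : OverlapCertificate ρ σ c) : (ρ * σ).trace = c := by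
  rw [h.mul_eq', Matrix.trace_smul, h.isState.2]
  simp

theorem isGreatest (h : OverlapCertificate ρ σ c) :
    IsGreatest {r : ℝ | ∃ σ ∈ SEP ι, r = (ρ * σ).trace.re} c :=
  ⟨⟨σ, h.mem_SEP, by rw [h.trace_mul, Complex.ofReal_re]⟩, by
    rintro _ ⟨τ, hτ, rfl⟩
    exact h.bound.trace_le hτ⟩

theorem one_le_inv (h : OverlapCertificate ρ σ c) (hρ : (c⁻¹ • σ - ρ).PosSemidef) : 1 ≤ c⁻¹ := by
  have := (Complex.le_def.mp hρ.trace_nonneg).1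
  rw [Matrix.trace_sub, Matrix.trace_smul, (isState_of_mem_SEP h.mem_SEP).2, h.isState.2] at this
  simpa using this

variable [∀ l, DecidableEq (ι l)]

theorem GM_eq (h : OverlapCertificate ρ σ c) : GM ι ρ = -Real.logb 2 c := by
  rw [GM, maxOverlap, h.isGreatest.csSup_eq, Real.sqrt_eq_rpow,
    Real.logb_rpow_eq_mul_logb_of_pos h.pos]
  ring

/-- The overlap is multiplicative against any `τ`, since `ProductBound.tensor` asks for non-negative
entries in one factor only. -/
theorem GM_isStrongAdditive (h : OverlapCertificate ρ σ c) : IsStrongAdditive GM ρ := by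
  intro κ _ _ τ hτ
  set S : Set ℝ := {r : ℝ | ∃ σ ∈ SEP κ, r = (τ * σ).trace.re} with hS
  have hne : ∀ l, Nonempty (κ l) := by
    intro l
    by_contra hl
    rw [not_nonempty_iff] at hl
    have : IsEmpty (∀ l, κ l) := ⟨fun x => hl.elim (x l)⟩
    have := hτ.2
    simp [Matrix.trace] at this
  have hmix : ∀ l, IsState ((Fintype.card (κ l) : ℝ)⁻¹ • (1 : Matrix (κ l) (κ l) ℂ)) := fun l =>
    ⟨real_smul_posSemidef Matrix.PosSemidef.one (by positivity), by
      rw [Matrix.trace_smul, Matrix.trace_one, Complex.real_smul]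
      simp⟩
  have hone : productOp (fun l => (1 : Matrix (κ l) (κ l) ℂ)) = 1 := by
    ext x y
    rcases eq_or_ne x y with rfl | hxy
    · rw [Matrix.one_apply_eq]
      exact Finset.prod_eq_one fun l _ => Matrix.one_apply_eq _
    · rw [Matrix.one_apply_ne hxy]
      obtain ⟨l, hl⟩ := Function.ne_iff.mp hxy
      exact Finset.prod_eq_zero (Finset.mem_univ l) (Matrix.one_apply_ne hl)
  -- The maximally mixed product state has positive overlap with every state, so the logarithm of
  -- the supremum splits correctly.
  have hpos : ∃ r ∈ S, 0 < r := by
    refine ⟨_, ⟨_, subset_convexHull ℝ _ ⟨_, hmix, rfl⟩, rfl⟩, ?_⟩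
    rw [productOp_smul, hone, mul_smul_comm, mul_one, Matrix.trace_smul, hτ.2]
    simp only [Complex.real_smul, mul_one, Complex.ofReal_re]
    exact Finset.prod_pos fun l _ => inv_pos.mpr (by exact_mod_cast Fintype.card_pos)
  have hbdd : BddAbove S := by
    refine ⟨1, ?_⟩
    rintro _ ⟨σ, hσ, rfl⟩
    have h1 := isState_of_mem_SEP hσ
    have h2 := trace_mul_re_le hτ.1 h1.1
    rwa [hτ.2, h1.2, Complex.one_re, one_mul] at h2
  have hs : 0 < sSup S := by
    obtain ⟨r, hr, hr0⟩ := hpos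
    exact hr0.trans_le (le_csSup hbdd hr)
  have hτb : ProductBound τ (sSup S) :=
    productBound_of_forall_trace_le fun σ hσ => le_csSup hbdd ⟨σ, hσ, rfl⟩
  -- A least upper bound suffices: the overlap of `τ` need not be shown to be attained.
  have key : IsLUB {r : ℝ | ∃ σ ∈ SEP (fun l => ι l × κ l), r = (tensor ρ τ * σ).trace.re}
      (c * sSup S) := by
    constructor
    · rintro _ ⟨σ, hσ, rfl⟩
      exact (h.bound.tensor h.entry_nonneg hτb hτ.1 hs.le).trace_le hσ
    · intro b hb
      rw [mul_comm, ← le_div_iff₀ h.pos]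
      refine csSup_le (hpos.imp fun _ h => h.1) ?_
      rintro _ ⟨σ', hσ', rfl⟩
      rw [le_div_iff₀ h.pos]
      refine hb ⟨_, tensor_mem_SEP h.mem_SEP hσ', ?_⟩
      rw [trace_tensor_mul_tensor, h.trace_mul, Complex.re_ofReal_mul, mul_comm]
  have hne' : {r : ℝ | ∃ σ ∈ SEP (fun l => ι l × κ l), r = (tensor ρ τ * σ).trace.re}.Nonempty :=
    key.nonempty
  rw [GM, GM, GM, maxOverlap, key.csSup_eq hne', maxOverlap, h.isGreatest.csSup_eq, maxOverlap,
    Real.sqrt_mul h.pos.le, Real.logb_mul (Real.sqrt_pos.mpr h.pos).ne' (Real.sqrt_pos.mpr hs).ne']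
  ring

/-- The logarithm of `σ` acts on the range of `ρ` as `log c`, which gives the upper bound. The lower
bound is `trace_mul_cfc_logb_le`, every separable state having overlap at most `c` with `ρ`. -/
theorem REE_eq (h : OverlapCertificate ρ σ c) :
    REE ι ρ = (((ρ * cfc (Real.logb 2) ρ).trace.re - Real.logb 2 c : ℝ) : EReal) := by
  have hre : ∀ τ : Op ι, (ρ * (cfc (Real.logb 2) ρ - cfc (Real.logb 2) τ)).trace.re =
      (ρ * cfc (Real.logb 2) ρ).trace.re - (ρ * cfc (Real.logb 2) τ).trace.re := fun τ => by
    rw [mul_sub, Matrix.trace_sub, Complex.sub_re]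
  refine le_antisymm (iInf₂_le_of_le σ h.mem_SEP ?_) (le_iInf₂ fun τ hτ => ?_)
  · rw [relativeEntropy, if_pos, hre, Matrix.trace_mul_comm ρ (cfc (Real.logb 2) σ),
      cfc_mul_of_mul_eq_smul (isState_of_mem_SEP h.mem_SEP).1.isHermitian h.mul_eq,
      Matrix.trace_smul, h.isState.2, Complex.smul_re, Complex.one_re, smul_eq_mul, mul_one]
    intro v hv
    have := congrArg (fun A => A *ᵥ v) h.mul_eq'
    simp only [← Matrix.mulVec_mulVec, hv, Matrix.mulVec_zero, Matrix.smul_mulVec] at this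
    exact (smul_eq_zero.mp this.symm).resolve_left h.pos.ne'
  · rw [relativeEntropy]
    split_ifs with hker
    · rw [hre]
      exact EReal.coe_le_coe_iff.mpr (sub_le_sub_left (trace_mul_cfc_logb_le h.isState
        (isState_of_mem_SEP hτ).1 hker h.pos (h.bound.trace_le hτ)) _)
    · exact le_top

/-- The part of `σ` outside the projector `ρ` is an admissible noise, so `1 + t = c⁻¹` is feasible.
Conversely, a separable mixture `(ρ + tΔ) / (1 + t)` has overlap at least `1 / (1 + t)` with `ρ`,
and at most `c`. -/
theorem LGR_eq (h : OverlapCertificate ρ σ c) (hρ : ρ * ρ = ρ) : LGR ι ρ = -Real.logb 2 c := by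
  have hσ := isState_of_mem_SEP h.mem_SEP
  have hherm : ρᴴ = ρ := h.isState.1.isHermitian
  have hps : (c⁻¹ • σ - ρ).PosSemidef := by
    have h1 : σ - c • ρ = (1 - ρ)ᴴ * σ * (1 - ρ) := by
      rw [Matrix.conjTranspose_sub, Matrix.conjTranspose_one, hherm, sub_mul, mul_sub, one_mul,
        mul_one, h.mul_eq', sub_mul, h.mul_eq, Matrix.smul_mul, hρ]
      abel
    have h2 : (σ - c • ρ).PosSemidef := h1 ▸ hσ.1.conjTranspose_mul_mul_same _
    have := real_smul_posSemidef h2 (inv_nonneg.mpr h.pos.le)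
    rwa [smul_sub, smul_smul, inv_mul_cancel₀ h.pos.ne', one_smul] at this
  have hc1 := h.one_le_inv hps
  have hc0 : c ≠ 0 := h.pos.ne'
  have key : IsLeast {t : ℝ | 0 ≤ t ∧ ∃ Δ : Op ι, IsState Δ ∧
      (1 + t)⁻¹ • (ρ + t • Δ) ∈ SEP ι} (c⁻¹ - 1) := by
    constructor
    · refine ⟨sub_nonneg.mpr hc1, ?_⟩
      rw [add_sub_cancel, inv_inv]
      -- For `c = 1` the noise has trace zero and cannot be normalised; then `σ = ρ`, and any state
      -- serves as `Δ`.
      rcases eq_or_ne (c⁻¹ - 1) 0 with h0 | h0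
      · have hc : c = 1 := inv_eq_one.mp (sub_eq_zero.mp h0)
        subst hc
        refine ⟨ρ, h.isState, ?_⟩
        have h3 : (1 : ℝ)⁻¹ • σ - ρ = 0 := by
          refine hps.trace_eq_zero_iff.mp ?_
          rw [Matrix.trace_sub, Matrix.trace_smul, hσ.2, h.isState.2]
          simp
        rw [inv_one, one_smul, sub_eq_zero] at h3
        rw [h0, zero_smul, add_zero, one_smul, ← h3]
        exact h.mem_SEP
      · refine ⟨(c⁻¹ - 1)⁻¹ • (c⁻¹ • σ - ρ), ⟨real_smul_posSemidef hps
          (inv_nonneg.mpr (sub_nonneg.mpr hc1)), ?_⟩, ?_⟩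
        · rw [Matrix.trace_smul, Matrix.trace_sub, Matrix.trace_smul, hσ.2, h.isState.2]
          simp only [Complex.real_smul, mul_one]
          rw [← Complex.ofReal_one, ← Complex.ofReal_sub, ← Complex.ofReal_mul,
            inv_mul_cancel₀ h0]
        · rw [smul_smul, mul_inv_cancel₀ h0, one_smul, add_sub_cancel, smul_smul,
            mul_inv_cancel₀ hc0, one_smul]
          exact h.mem_SEP
    · rintro t ⟨ht, Δ, hΔ, hmem⟩
      have h1 := h.bound.trace_le hmem
      rw [Matrix.mul_smul, mul_add, hρ, Matrix.trace_smul, Matrix.trace_add, h.isState.2,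
        Matrix.mul_smul, Matrix.trace_smul, Complex.smul_re, Complex.add_re, Complex.smul_re,
        Complex.one_re, smul_eq_mul, smul_eq_mul, inv_mul_le_iff₀ (by linarith)] at h1
      have h2 := mul_nonneg ht (trace_mul_re_nonneg h.isState.1 hΔ.1)
      rw [sub_le_iff_le_add, inv_le_iff_one_le_mul₀ h.pos]
      linarith
  rw [LGR, globalRobustness, key.csInf_eq, add_sub_cancel, Real.logb_inv]

theorem hasAsymptotic_GM (h : OverlapCertificate ρ σ c) : HasAsymptotic GM ρ (-Real.logb 2 c) := by
  refine tendsto_const_nhds.congr' ?_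
  filter_upwards [eventually_gt_atTop 0] with n hn
  have : (n : ℝ) ≠ 0 := by exact_mod_cast hn.ne'
  rw [(h.copies n).GM_eq, Real.logb_pow]
  field_simp

theorem hasAsymptotic_LGR (h : OverlapCertificate ρ σ c) (hρ : ρ * ρ = ρ) :
    HasAsymptotic LGR ρ (-Real.logb 2 c) := by
  refine tendsto_const_nhds.congr' ?_
  filter_upwards [eventually_gt_atTop 0] with n hn
  have : (n : ℝ) ≠ 0 := by exact_mod_cast hn.ne'
  rw [(h.copies n).LGR_eq (by rw [copies_mul_copies, hρ]), Real.logb_pow]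
  field_simp

end OverlapCertificate

end Certificate

/-! ### Entropy of tensor powers and asymptotic relative entropy. -/

section Entropy

/-- `ρ = ∑ⱼ q j |χ j⟩⟨χ j|` with positive weights and orthonormal `χ j`. -/
structure SpectralResolution {n : Type} [Fintype n] (ρ : Matrix n n ℂ) {J : Type} [Fintype J]
    (q : J → ℝ) (T : J → Matrix n n ℂ) : Prop where
  sum_eq : ρ = ∑ j, q j • T j
  trace_eq : ∀ j, (T j).trace = 1
  mul_eq : ∀ j, ρ * T j = q j • T j

theorem SpectralResolution.trace_mul_cfc {n : Type} [Fintype n] [DecidableEq n]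
    {ρ : Matrix n n ℂ} (hρ : ρ.IsHermitian) {J : Type} [Fintype J]
    {q : J → ℝ} {T : J → Matrix n n ℂ} (h : SpectralResolution ρ q T) (f : ℝ → ℝ) :
    (ρ * cfc f ρ).trace.re = ∑ j, q j * f (q j) := by
  rw [Matrix.trace_mul_comm]
  conv_lhs => enter [1, 1, 2]; rw [h.sum_eq]
  rw [Matrix.mul_sum, Matrix.trace_sum, Complex.re_sum]
  refine Finset.sum_congr rfl fun j _ => ?_
  rw [Matrix.mul_smul, cfc_mul_of_mul_eq_smul hρ (h.mul_eq j), Matrix.trace_smul,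
    Matrix.trace_smul, h.trace_eq]
  simp

variable {P : Type} [Fintype P] [DecidableEq P]
variable {ι : P → Type} [∀ l, Fintype (ι l)]

theorem SpectralResolution.copies {ρ : Op ι} {J : Type} [Fintype J]
    {q : J → ℝ} {T : J → Op ι} (h : SpectralResolution ρ q T) (n : ℕ) :
    SpectralResolution (copies ρ n) (fun j : Fin n → J => ∏ m, q (j m))
      (fun j : Fin n → J => (productOp fun m => T (j m)).submatrix
        (Equiv.piComm fun l (_ : Fin n) => ι l) (Equiv.piComm fun l (_ : Fin n) => ι l)) where
  sum_eq := by
    ext x y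
    simp only [MultipartiteEntanglement.copies, Matrix.sum_apply, Matrix.smul_apply]
    conv_lhs => enter [2, m]; rw [h.sum_eq, Matrix.sum_apply]
    rw [Fintype.prod_sum]
    refine Finset.sum_congr rfl fun j _ => ?_
    simp only [Matrix.smul_apply, Complex.real_smul, Finset.prod_mul_distrib, Complex.ofReal_prod]
    rfl
  trace_eq j := by
    have := sum_prod_copies (ι := ι) fun (m : Fin n) x => T (j m) x x
    refine this.trans ?_
    exact Finset.prod_eq_one fun m _ => h.trace_eq (j m)
  mul_eq j := by
    ext x y
    have := sum_prod_copies (ι := ι) fun (m : Fin n) z =>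
      ρ (fun l => x l m) z * T (j m) z (fun l => y l m)
    simp only [Finset.prod_mul_distrib] at this
    refine this.trans ?_
    have h2 : ∀ m, ∑ z, ρ (fun l => x l m) z * T (j m) z (fun l => y l m) =
      q (j m) * T (j m) (fun l => x l m) (fun l => y l m) := fun m => by
      rw [← Matrix.mul_apply, h.mul_eq, Matrix.smul_apply, Complex.real_smul]
    simp only [h2, Finset.prod_mul_distrib, Matrix.smul_apply, Complex.real_smul,
      Complex.ofReal_prod]
    rfl

/-- Additivity of Shannon entropy for independent copies: the logarithm of a product is a sum over
copies `m₀`, and in each summand the other copies sum to 1. -/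
theorem sum_prod_mul_logb_prod {J : Type} [Fintype J] {q : J → ℝ} (hq : ∀ j, 0 < q j)
    (hq1 : ∑ j, q j = 1) (n : ℕ) :
    ∑ j : Fin n → J, (∏ m, q (j m)) * Real.logb 2 (∏ m, q (j m)) =
      n * ∑ j, q j * Real.logb 2 (q j) := by
  have h1 : ∀ j : Fin n → J, (∏ m, q (j m)) * Real.logb 2 (∏ m, q (j m)) =
      ∑ m₀, ∏ m, if m = m₀ then q (j m) * Real.logb 2 (q (j m)) else q (j m) := by
    intro j
    rw [Real.logb_prod _ _ fun m _ => (hq _).ne', Finset.mul_sum]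
    refine Finset.sum_congr rfl fun m₀ _ => ?_
    rw [← Finset.mul_prod_erase _ _ (Finset.mem_univ m₀),
      ← Finset.mul_prod_erase _ (fun m => if m = m₀ then _ else _) (Finset.mem_univ m₀), if_pos rfl,
      Finset.prod_congr rfl fun m hm => if_neg (Finset.ne_of_mem_erase hm)]
    ring
  simp only [h1]
  rw [Finset.sum_comm]
  have h2 : ∀ m₀ : Fin n, ∑ j : Fin n → J, ∏ m,
      (if m = m₀ then q (j m) * Real.logb 2 (q (j m)) else q (j m)) =
      ∑ j, q j * Real.logb 2 (q j) := by
    intro m₀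
    rw [← Fintype.prod_sum fun m j => if m = m₀ then q j * Real.logb 2 (q j) else q j,
      Fintype.prod_eq_single m₀]
    · simp
    · intro m hm
      simp [hm, hq1]
  simp [h2]

variable [∀ l, DecidableEq (ι l)]

theorem OverlapCertificate.REE_copies {ρ σ : Op ι} {c : ℝ} (h : OverlapCertificate ρ σ c)
    {J : Type} [Fintype J] {q : J → ℝ} {T : J → Op ι} (hT : SpectralResolution ρ q T)
    (hq : ∀ j, 0 < q j) (n : ℕ) :
    REE (fun l => Fin n → ι l) (MultipartiteEntanglement.copies ρ n) =
      ((n * (∑ j, q j * Real.logb 2 (q j) - Real.logb 2 c) : ℝ) : EReal) := by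
  have hq1 : ∑ j, q j = 1 := by
    have := congrArg Complex.re h.isState.2
    rw [hT.sum_eq, Matrix.trace_sum, Complex.re_sum] at this
    simpa [Matrix.trace_smul, hT.trace_eq] using this
  rw [(h.copies n).REE_eq, (hT.copies n).trace_mul_cfc (h.copies n).isState.1.isHermitian,
    sum_prod_mul_logb_prod hq hq1, Real.logb_pow, mul_sub]

theorem OverlapCertificate.REE_eq_of_spectralResolution {ρ σ : Op ι} {c : ℝ}
    (h : OverlapCertificate ρ σ c) {J : Type} [Fintype J] {q : J → ℝ} {T : J → Op ι}
    (hT : SpectralResolution ρ q T) :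
    REE ι ρ = ((∑ j, q j * Real.logb 2 (q j) - Real.logb 2 c : ℝ) : EReal) := by
  rw [h.REE_eq, hT.trace_mul_cfc h.isState.1.isHermitian]

theorem OverlapCertificate.hasAsymptotic_REE {ρ σ : Op ι} {c : ℝ} (h : OverlapCertificate ρ σ c)
    {J : Type} [Fintype J] {q : J → ℝ} {T : J → Op ι} (hT : SpectralResolution ρ q T)
    (hq : ∀ j, 0 < q j) :
    HasAsymptotic REE ρ ((∑ j, q j * Real.logb 2 (q j) - Real.logb 2 c : ℝ) : EReal) := by
  refine tendsto_const_nhds.congr' ?_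
  filter_upwards [eventually_gt_atTop 0] with n hn
  have hn : (n : ℝ) ≠ 0 := by exact_mod_cast hn.ne'
  rw [h.REE_copies hT hq, ← EReal.coe_coe_eq_natCast, ← EReal.coe_div]
  congr 1
  field_simp

end Entropy

/-! ### Banach's theorem for symmetric multilinear forms on non-negative vectors. -/

section Banach

variable {P : Type}
variable {ι : Type} [Fintype ι]

variable (P ι) in
/-- Families of non-negative unit vectors. -/
def nonnegUnitFamilies : Set (P → ι → ℝ) :=
  {c | (∀ l j, 0 ≤ c l j) ∧ ∀ l, c l ⬝ᵥ c l = 1}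

theorem isCompact_nonnegUnitFamilies : IsCompact (nonnegUnitFamilies P ι) := by
  refine (isCompact_Icc (a := (0 : P → ι → ℝ)) (b := 1)).of_isClosed_subset ?_ ?_
  · simp only [nonnegUnitFamilies, Set.ofPred_and, Set.ofPred_forall]
    refine IsClosed.inter ?_ ?_
    · exact isClosed_iInter fun l => isClosed_iInter fun j =>
        isClosed_le (by fun_prop) (by fun_prop)
    · exact isClosed_iInter fun l => isClosed_eq (by unfold dotProduct; fun_prop) (by fun_prop)
  · rintro c ⟨h0, h1⟩
    refine ⟨fun l j => h0 l j, fun l j => ?_⟩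
    have h2 : c l j * c l j ≤ 1 := by
      rw [← h1 l]
      exact Finset.single_le_sum (f := fun j => c l j * c l j)
        (fun _ _ => mul_self_nonneg _) (Finset.mem_univ j)
    show c l j ≤ 1
    nlinarith [h0 l j]

theorem dotProduct_self_pos {v : ι → ℝ} (hv : v ≠ 0) : 0 < v ⬝ᵥ v := by
  refine lt_of_le_of_ne (Finset.sum_nonneg fun _ _ => mul_self_nonneg _) fun h => hv ?_
  exact dotProduct_self_eq_zero.mp h.symm

variable [DecidableEq P]

theorem update_mem_nonnegUnitFamilies {c : P → ι → ℝ} (hc : c ∈ nonnegUnitFamilies P ι) (l : P)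
    {v : ι → ℝ} (hv : ∀ j, 0 ≤ v j) (hv1 : v ⬝ᵥ v = 1) :
    Function.update c l v ∈ nonnegUnitFamilies P ι := by
  refine ⟨fun m j => ?_, fun m => ?_⟩
  all_goals
    rcases eq_or_ne m l with rfl | h
    · simp [hv, hv1]
    · simp [h, hc.1, hc.2]

variable {F : MultilinearMap ℝ (fun _ : P => ι → ℝ) ℝ}

/-- At a maximizer, the derivative in each argument is parallel to that argument. -/
theorem map_update_eq_of_isMaxOn (hnn : ∀ c : P → ι → ℝ, (∀ l j, 0 ≤ c l j) → 0 ≤ F c)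
    {c : P → ι → ℝ} (hc : c ∈ nonnegUnitFamilies P ι)
    (hmax : IsMaxOn F (nonnegUnitFamilies P ι) c) (l : P) (v : ι → ℝ) :
    F (Function.update c l v) = F c * (c l ⬝ᵥ v) := by
  classical
  set D : ι → ℝ := fun j => F (Function.update c l (Pi.single j 1)) with hD
  have hlin : ∀ v, F (Function.update c l v) = D ⬝ᵥ v := by
    intro v
    have h := (F.toLinearMap c l).pi_apply_eq_sum_univ v
    simp only [MultilinearMap.toLinearMap_apply, smul_eq_mul] at h
    rw [h, dotProduct]
    refine Finset.sum_congr rfl fun j _ => ?_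
    rw [mul_comm, hD]
    congr 3
    ext k
    simp [Pi.single_apply, eq_comm]
  have hD0 : ∀ j, 0 ≤ D j := by
    intro j
    refine hnn _ fun m k => ?_
    rcases eq_or_ne m l with rfl | h
    · simp only [Function.update_self, Pi.single_apply]
      split_ifs <;> norm_num
    · simp [h, hc.1]
  have hDa : D ⬝ᵥ c l = F c := by rw [← hlin, Function.update_eq_self]
  have hDD : D ⬝ᵥ D ≤ F c ^ 2 := by
    rcases eq_or_ne D 0 with h0 | h0
    · rw [h0, zero_dotProduct]; positivity
    · have hpos := dotProduct_self_pos h0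
      set s := √(D ⬝ᵥ D) with hs
      have hs0 : 0 < s := Real.sqrt_pos.mpr hpos
      have hss : s * s = D ⬝ᵥ D := Real.mul_self_sqrt hpos.le
      -- The normalised gradient `D` is itself an admissible argument, and the value of `F` there is
      -- the norm of `D`.
      have h1 : F (Function.update c l (s⁻¹ • D)) ≤ F c := by
        refine hmax (update_mem_nonnegUnitFamilies hc l (fun j => ?_) ?_)
        · exact mul_nonneg (inv_nonneg.mpr hs0.le) (hD0 j)
        · rw [smul_dotProduct, dotProduct_smul, ← hss]
          simp only [smul_eq_mul]
          field_simp
      rw [hlin, dotProduct_smul, ← hss, smul_eq_mul, inv_mul_cancel_left₀ hs0.ne'] at h1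
      rw [← hss, ← sq]
      gcongr
  -- Equality case of Cauchy–Schwarz: the squared norm of this difference is `D ⬝ᵥ D - F c ^ 2`,
  -- which is at most zero.
  have hkey : D - F c • c l = 0 := by
    rw [← dotProduct_self_eq_zero]
    refine le_antisymm ?_ (Finset.sum_nonneg fun _ _ => mul_self_nonneg _)
    simp only [sub_dotProduct, dotProduct_sub, smul_dotProduct, dotProduct_smul, smul_eq_mul, hDa,
      hc.2 l, dotProduct_comm (c l) D]
    nlinarith
  rw [hlin, sub_eq_zero.mp hkey, smul_dotProduct, smul_eq_mul]

variable [Fintype P]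

/-- Banach's theorem: a symmetric multilinear form that is non-negative on non-negative vectors
attains its maximum over families of non-negative unit vectors on the diagonal. -/
theorem le_of_forall_diagonal_le (hcont : Continuous F)
    (hnn : ∀ c : P → ι → ℝ, (∀ l j, 0 ≤ c l j) → 0 ≤ F c)
    (hsymm : ∀ (e : Equiv.Perm P) (c : P → ι → ℝ), F (fun l => c (e l)) = F c) {B : ℝ}
    (hB : ∀ u : ι → ℝ, (∀ j, 0 ≤ u j) → u ⬝ᵥ u ≤ 1 → F (fun _ => u) ≤ B)
    {c : P → ι → ℝ} (hc : c ∈ nonnegUnitFamilies P ι) : F c ≤ B := by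
  obtain ⟨c₁, hc₁, hmax₁⟩ := isCompact_nonnegUnitFamilies.exists_isMaxOn ⟨c, hc⟩ hcont.continuousOn
  -- Among all maximizers of `F`, one is chosen whose vectors have the longest sum.
  set g : (P → ι → ℝ) → ℝ := fun c => (∑ l, c l) ⬝ᵥ (∑ l, c l) with hg
  have hgc : Continuous g := by
    simp only [hg, dotProduct, Finset.sum_apply]
    fun_prop
  obtain ⟨c₂, ⟨hc₂, hF₂⟩, hmax₂⟩ := (isCompact_nonnegUnitFamilies.inter_right
    (isClosed_singleton.preimage hcont (t := {F c₁}))).exists_isMaxOn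
    ⟨c₁, hc₁, rfl⟩ hgc.continuousOn
  have hF₂ : F c₂ = F c₁ := hF₂
  have hmaxF : IsMaxOn F (nonnegUnitFamilies P ι) c₂ := fun x hx => by
    show F x ≤ F c₂
    rw [hF₂]; exact hmax₁ hx
  have heq : ∀ l m, c₂ l = c₂ m := by
    by_contra! hne
    obtain ⟨l, m, hlm⟩ := hne
    have hl : m ≠ l := fun h => hlm (by rw [h])
    set a := c₂ l with ha
    set b := c₂ m with hb
    have haa : a ⬝ᵥ a = 1 := hc₂.2 l
    have hbb : b ⬝ᵥ b = 1 := hc₂.2 m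
    have hab : 0 ≤ a ⬝ᵥ b := Finset.sum_nonneg fun j _ => mul_nonneg (hc₂.1 l j) (hc₂.1 m j)
    have hab1 : a ⬝ᵥ b < 1 := by
      have := dotProduct_self_pos (sub_ne_zero.mpr hlm)
      simp only [sub_dotProduct, dotProduct_sub, haa, hbb, dotProduct_comm b a] at this
      linarith
    set s := √(2 + 2 * (a ⬝ᵥ b)) with hs
    have hs0 : 0 < s := Real.sqrt_pos.mpr (by linarith)
    have hss : s * s = 2 + 2 * (a ⬝ᵥ b) := Real.mul_self_sqrt (by linarith)
    have hs2 : s < 2 := by nlinarith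
    -- Two distinct arguments `a`, `b` are both replaced by their normalised sum. The value of `F`
    -- will not change, but the sum of all arguments will become strictly longer.
    set u : ι → ℝ := s⁻¹ • (a + b) with hu
    have hu0 : ∀ j, 0 ≤ u j := fun j =>
      mul_nonneg (inv_nonneg.mpr hs0.le) (add_nonneg (hc₂.1 l j) (hc₂.1 m j))
    have huu : u ⬝ᵥ u = 1 := by
      simp only [hu, smul_dotProduct, dotProduct_smul, add_dotProduct, dotProduct_add, haa, hbb,
        dotProduct_comm b a, smul_eq_mul]
      have h1 : s⁻¹ * (s⁻¹ * (s * s)) = 1 := by field_simp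
      rw [hss] at h1
      linear_combination h1
    have hsu : a + b = s • u := by rw [hu, smul_smul, mul_inv_cancel₀ hs0.ne', one_smul]
    set G : (ι → ℝ) → (ι → ℝ) → ℝ :=
      fun v w => F (Function.update (Function.update c₂ l v) m w) with hG
    have hGl : ∀ v v' w, G (v + v') w = G v w + G v' w := fun v v' w => by
      simp only [hG, Function.update_comm hl.symm, F.map_update_add]
    have hGr : ∀ v w w', G v (w + w') = G v w + G v w' := fun v w w' => by
      simp only [hG, F.map_update_add]
    have hGs : ∀ (r : ℝ) v, G (r • v) (r • v) = r * (r * G v v) := fun r v => by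
      simp only [hG, F.map_update_smul]
      simp only [Function.update_comm hl.symm, F.map_update_smul, smul_eq_mul]
    have hGab : G a b = F c₂ := by simp only [hG, ha, hb, Function.update_eq_self]
    have hGba : G b a = F c₂ := by
      rw [← hsymm (Equiv.swap l m) c₂]
      refine congrArg F (funext fun k => ?_)
      rcases eq_or_ne k m with rfl | hkm
      · simp [ha]
      · rcases eq_or_ne k l with rfl | hkl
        · simp [hb, hkm]
        · simp [hkm, hkl, Equiv.swap_apply_of_ne_of_ne hkl hkm]
    have hGbb : G b b = F c₂ * (a ⬝ᵥ b) := by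
      rw [← map_update_eq_of_isMaxOn hnn hc₂ hmaxF l b]
      refine congrArg F ?_
      rw [Function.update_eq_self_iff, Function.update_of_ne hl]
    have hGaa : G a a = F c₂ * (a ⬝ᵥ b) := by
      rw [dotProduct_comm, ← map_update_eq_of_isMaxOn hnn hc₂ hmaxF m a]
      refine congrArg F ?_
      simp only [ha, Function.update_eq_self]
    -- The four terms of `G (a + b) (a + b)` add up to `(2 + 2 * (a ⬝ᵥ b)) * F c₂`, and the scalar
    -- is `s * s`.
    have hGuu : G u u = F c₂ := by
      have h1 : G (a + b) (a + b) = s * (s * G u u) := by rw [hsu, hGs]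
      rw [hGl, hGr, hGr, hGab, hGba, hGaa, hGbb, ← mul_assoc, hss] at h1
      have h2 : (2 + 2 * (a ⬝ᵥ b)) * (G u u - F c₂) = 0 := by linarith
      have h3 := (mul_eq_zero.mp h2).resolve_left (by linarith)
      linarith
    have hmem : Function.update (Function.update c₂ l u) m u ∈ nonnegUnitFamilies P ι :=
      update_mem_nonnegUnitFamilies (update_mem_nonnegUnitFamilies hc₂ l hu0 huu) m hu0 huu
    have hle : g (Function.update (Function.update c₂ l u) m u) ≤ g c₂ :=
      hmax₂ ⟨hmem, hGuu.trans hF₂⟩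
    have hsum : ∑ k, Function.update (Function.update c₂ l u) m u k =
        (∑ k, c₂ k) + (2 - s) • u := by
      have h1 : ∀ k, Function.update (Function.update c₂ l u) m u k =
          c₂ k + ((Pi.single l (u - a) : P → ι → ℝ) k + (Pi.single m (u - b) : P → ι → ℝ) k) := by
        intro k
        rcases eq_or_ne k m with rfl | hkm
        · simp [hl, hb]
        · rcases eq_or_ne k l with rfl | hkl
          · simp [hkm, ha]
          · simp [hkm, hkl]
      simp only [h1, Finset.sum_add_distrib, Fintype.sum_pi_single']
      rw [sub_smul, ← hsu, two_smul]
      abel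
    -- Non-negativity makes the cross term harmless, so adding `(2 - s) • u` strictly lengthens the
    -- sum, against the choice of `c₂`.
    have hSu : 0 ≤ (∑ k, c₂ k) ⬝ᵥ u := Finset.sum_nonneg fun j _ => mul_nonneg
      (by rw [Finset.sum_apply]; exact Finset.sum_nonneg fun k _ => hc₂.1 k j) (hu0 j)
    rw [hg] at hle
    simp only [hsum, add_dotProduct, dotProduct_add, smul_dotProduct, dotProduct_smul, huu,
      dotProduct_comm u (∑ k, c₂ k), smul_eq_mul] at hle
    nlinarith [mul_nonneg (sub_nonneg.mpr hs2.le) hSu, mul_pos (sub_pos.mpr hs2) (sub_pos.mpr hs2)]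
  refine (hmax₁ hc).trans ?_
  show F c₁ ≤ B
  rw [← hF₂]
  rcases isEmpty_or_nonempty P with hP | ⟨⟨l⟩⟩
  · rw [Subsingleton.elim c₂ fun _ => 0]
    exact hB 0 (fun _ => le_rfl) (by simp)
  · rw [show c₂ = fun _ => c₂ l from funext fun m => heq m l]
    exact hB _ (hc₂.1 l) (hc₂.2 l).le

end Banach

/-! ### Words, types, and the phase-averaged product state. -/

section Types

variable {P : Type} [Fintype P] {d : ℕ}

/-- The number of occurrences of each symbol in the word `x`. -/
def occ (x : P → Fin d) (j : Fin d) : ℕ := (Finset.univ.filter fun l => x l = j).card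

theorem occ_le (x : P → Fin d) (j : Fin d) : occ x j ≤ Fintype.card P := Finset.card_le_univ _

theorem prod_comp_eq_prod_pow_occ {M : Type} [CommMonoid M] (u : Fin d → M) (x : P → Fin d) :
    ∏ l, u (x l) = ∏ j, u j ^ occ x j := by
  rw [← Finset.prod_fiberwise' Finset.univ x u]
  simp [occ]

theorem occ_comp_perm (e : Equiv.Perm P) (x : P → Fin d) : occ (x ∘ e) = occ x := by
  ext j
  refine Finset.card_bij (fun l _ => e l) ?_ ?_ ?_
  · simp
  · simp
  · intro l hl
    exact ⟨e.symm l, by simpa using hl, by simp⟩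

variable (P) in
/-- The dephased product state `∑ₖ q^k |words k| · typeProj k`. -/
def dephasedProduct (q : Fin d → ℝ) : Op (fun _ : P => Fin d) :=
  fun x y => if occ x = occ y then ∏ l, ((√(q (x l)) : ℂ) * √(q (y l))) else 0

theorem sum_root_of_unity_pow {K : ℕ} (hK : 0 < K) {ζ : ℂ} (hζ : IsPrimitiveRoot ζ K) {a b : ℕ}
    (ha : a < K) (hb : b < K) :
    ∑ t : Fin K, (ζ ^ (t : ℕ)) ^ a * (star (ζ ^ (t : ℕ))) ^ b = if a = b then (K : ℂ) else 0 := by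
  have hstar : ζ * star ζ = 1 := by
    rw [Complex.star_def, Complex.mul_conj', hζ.norm'_eq_one hK.ne']
    simp
  set ω : ℂ := ζ ^ a * star ζ ^ b with hω
  have h1 : ∀ t : ℕ, (ζ ^ t) ^ a * (star (ζ ^ t)) ^ b = ω ^ t := fun t => by
    rw [star_pow, hω, mul_pow]
    ring
  simp only [h1]
  rw [Fin.sum_univ_eq_sum_range fun t => ω ^ t]
  split_ifs with hab
  · have : ω = 1 := by rw [hω, hab, ← mul_pow, hstar, one_pow]
    simp [this]
  · have hne : ω ≠ 1 := by
      intro h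
      refine hab (hζ.pow_inj ha hb ?_)
      calc ζ ^ a = ω * ζ ^ b := by
            rw [hω, mul_assoc, ← mul_pow, mul_comm (star ζ), hstar, one_pow, mul_one]
        _ = ζ ^ b := by rw [h, one_mul]
    have hK1 : ω ^ K = 1 := by
      have h3 : star ζ ^ K = 1 := by rw [← star_pow, hζ.pow_eq_one, star_one]
      rw [hω, mul_pow, ← pow_mul, ← pow_mul, mul_comm a, mul_comm b, pow_mul, pow_mul,
        hζ.pow_eq_one, h3, one_pow, one_pow, one_mul]
    have := mul_geom_sum ω K
    rw [hK1, sub_self] at this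
    exact (mul_eq_zero.mp this).resolve_left (sub_ne_zero.mpr hne)

/-- Averaging the product of the vectors with components `√(q j) ζ^(θ j)` over all phases `θ` erases
exactly the entries between words of different type. -/
theorem dephasedProduct_mem_SEP {q : Fin d → ℝ} (hq : ∀ j, 0 ≤ q j) (hq1 : ∑ j, q j = 1) :
    dephasedProduct P q ∈ SEP (fun _ : P => Fin d) := by
  -- One more than the largest possible occurrence number, so that distinct exponents stay distinct
  -- modulo `K`.
  set K := Fintype.card P + 1 with hK
  have hK0 : K ≠ 0 := Nat.succ_ne_zero _
  set ζ : ℂ := Complex.exp (2 * Real.pi * Complex.I / K) with hζ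
  have hprim : IsPrimitiveRoot ζ K := Complex.isPrimitiveRoot_exp K hK0
  have hstar : ∀ t : ℕ, ζ ^ t * star (ζ ^ t) = 1 := fun t => by
    rw [Complex.star_def, Complex.mul_conj', norm_pow, hprim.norm'_eq_one hK0]
    simp
  set η : (Fin d → Fin K) → Fin d → ℂ := fun θ j => √(q j) * ζ ^ (θ j : ℕ) with hη
  have hη_state : ∀ θ, IsState (Matrix.vecMulVec (η θ) (star (η θ))) := by
    intro θ
    refine ⟨Matrix.posSemidef_vecMulVec_self_star _, ?_⟩
    rw [Matrix.trace_vecMulVec, dotProduct]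
    have h1 : ∀ j, η θ j * star (η θ) j = q j := fun j => by
      rw [Pi.star_apply, hη]
      simp only [star_mul']
      rw [mul_mul_mul_comm, hstar, mul_one, Complex.star_def, Complex.conj_ofReal,
        ← Complex.ofReal_mul, Real.mul_self_sqrt (hq j)]
    simp only [h1]
    exact_mod_cast hq1
  refine mem_convexHull_iff_exists_fintype.mpr ⟨Fin d → Fin K, inferInstance,
    fun _ => ((K : ℝ) ^ d)⁻¹, fun θ => productOp fun _ : P => Matrix.vecMulVec (η θ) (star (η θ)),
    fun _ => by positivity, ?_, fun θ => ⟨_, fun _ => hη_state θ, rfl⟩, ?_⟩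
  · rw [Finset.sum_const, nsmul_eq_mul, Finset.card_univ, Fintype.card_fun, Fintype.card_fin,
      Fintype.card_fin, Nat.cast_pow]
    exact mul_inv_cancel₀ (by positivity)
  · ext x y
    simp only [Matrix.sum_apply, Matrix.smul_apply, productOp, Matrix.vecMulVec_apply]
    have h1 : ∀ θ : Fin d → Fin K, ∏ l, η θ (x l) * star (η θ) (y l) =
        (∏ l, ((√(q (x l)) : ℂ) * √(q (y l)))) *
          ∏ j, (ζ ^ (θ j : ℕ)) ^ occ x j * (star (ζ ^ (θ j : ℕ))) ^ occ y j := by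
      intro θ
      have h2 : ∀ l, η θ (x l) * star (η θ) (y l) = ((√(q (x l)) : ℂ) * √(q (y l))) *
          (ζ ^ (θ (x l) : ℕ) * star (ζ ^ (θ (y l) : ℕ))) := fun l => by
        rw [Pi.star_apply, hη]
        simp only [star_mul']
        rw [mul_mul_mul_comm, Complex.star_def, Complex.conj_ofReal]
      simp only [h2]
      rw [Finset.prod_mul_distrib, Finset.prod_mul_distrib (f := fun l => ζ ^ (θ (x l) : ℕ)),
        prod_comp_eq_prod_pow_occ (fun j => ζ ^ (θ j : ℕ)),
        prod_comp_eq_prod_pow_occ (fun j => star (ζ ^ (θ j : ℕ))), Finset.prod_mul_distrib,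
        Finset.prod_mul_distrib]
    simp only [h1]
    rw [← Finset.smul_sum, ← Finset.mul_sum, ← Fintype.prod_sum fun j (t : Fin K) =>
      (ζ ^ (t : ℕ)) ^ occ x j * (star (ζ ^ (t : ℕ))) ^ occ y j]
    simp only [sum_root_of_unity_pow (Nat.pos_of_ne_zero hK0) hprim (Nat.lt_succ_of_le (occ_le x _))
      (Nat.lt_succ_of_le (occ_le y _))]
    rw [dephasedProduct]
    split_ifs with hxy
    · simp only [hxy, if_true, Finset.prod_const, Finset.card_univ, Fintype.card_fin,
        Complex.real_smul, Complex.ofReal_inv, Complex.ofReal_pow, Complex.ofReal_natCast]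
      have : (K : ℂ) ^ d ≠ 0 := pow_ne_zero _ (by exact_mod_cast hK0)
      field_simp
    · obtain ⟨j, hj⟩ := Function.ne_iff.mp hxy
      rw [Finset.prod_eq_zero (Finset.mem_univ j) (if_neg hj), mul_zero, smul_zero]

variable [DecidableEq P]

variable (P) in
/-- The words in which every symbol `j` occurs `k j` times. -/
def words (k : Fin d → ℕ) : Finset (P → Fin d) := Finset.univ.filter fun x => occ x = k

theorem mem_words {k : Fin d → ℕ} {x : P → Fin d} : x ∈ words P k ↔ occ x = k := by
  simp [words]

/-- Comparison of the coefficients of the monomial of exponent `k` in `(∑ X j) ^ |P|`, expanded by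
words and by the multinomial theorem. -/
theorem card_words_mul {k : Fin d → ℕ} (hk : ∑ j, k j = Fintype.card P) :
    (∏ j, (k j)!) * (words P k).card = (Fintype.card P)! := by
  have h1 : (∑ j : Fin d, MvPolynomial.X j : MvPolynomial (Fin d) ℕ) ^ Fintype.card P =
      ∑ x : P → Fin d, MvPolynomial.monomial (Finsupp.equivFunOnFinite.symm (occ x)) 1 := by
    rw [← Finset.card_univ, ← Finset.prod_const, Fintype.prod_sum]
    refine Finset.sum_congr rfl fun x _ => ?_
    rw [prod_comp_eq_prod_pow_occ, MvPolynomial.monomial_eq, Finsupp.prod_fintype _ _ (by simp)]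
    simp
  have h2 := congrArg (MvPolynomial.coeff (Finsupp.equivFunOnFinite.symm k)) h1
  rw [MvPolynomial.coeff_sum_X_pow_of_fintype,
    if_pos (by rw [Finsupp.sum_fintype _ _ (by simp)]; exact hk),
    MvPolynomial.coeff_sum] at h2
  simp only [MvPolynomial.coeff_monomial, EmbeddingLike.apply_eq_iff_eq, Finset.sum_boole] at h2
  have h3 : (words P k).card =
      Nat.multinomial Finset.univ k := by
    rw [words]
    simp only [Nat.cast_id] at h2
    rw [← h2]
    exact (Finsupp.multinomial_of_support_subset (Finset.subset_univ
      (Finsupp.equivFunOnFinite.symm k).support)).symm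
  rw [h3, Nat.multinomial_spec, hk]

theorem card_words_pos {k : Fin d → ℕ} (hk : ∑ j, k j = Fintype.card P) :
    0 < (words P k).card := by
  have := card_words_mul hk
  have h2 := Nat.factorial_pos (Fintype.card P)
  rw [← this] at h2
  exact Nat.pos_of_mul_pos_left h2

variable (P) in
/-- The projector on the span of the uniform superposition of the words of type `k`. -/
def typeProj (k : Fin d → ℕ) : Op (fun _ : P => Fin d) :=
  fun x y => if occ x = k ∧ occ y = k then ((words P k).card : ℂ)⁻¹ else 0

theorem typeProj_entry_nonneg (k : Fin d → ℕ) (x y : P → Fin d) : 0 ≤ typeProj P k x y := by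
  rw [typeProj]
  split_ifs
  · rw [← Complex.ofReal_natCast, ← Complex.ofReal_inv]
    exact Complex.zero_le_real.mpr (by positivity)
  · exact le_rfl

theorem typeProj_eq_vecMulVec (k : Fin d → ℕ) : typeProj P k =
    Matrix.vecMulVec (fun x => if occ x = k then ((1 / √((words P k).card : ℝ) : ℝ) : ℂ) else 0)
      (star fun x => if occ x = k then ((1 / √((words P k).card : ℝ) : ℝ) : ℂ) else 0) := by
  ext x y
  rw [typeProj, Matrix.vecMulVec_apply, Pi.star_apply]
  by_cases hx : occ x = k <;> by_cases hy : occ y = k <;> simp only [hx, hy, and_self, and_true,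
    and_false, if_true, if_false, star_zero, mul_zero, zero_mul]
  rw [Complex.star_def, Complex.conj_ofReal, ← Complex.ofReal_mul, div_mul_div_comm, one_mul,
    Real.mul_self_sqrt (by positivity)]
  simp

theorem typeProj_mul (k k' : Fin d → ℕ) (hk : ∑ j, k j = Fintype.card P) :
    typeProj P k * typeProj P k' = if k = k' then typeProj P k else 0 := by
  have hc : ((words P k).card : ℂ) ≠ 0 := by exact_mod_cast (card_words_pos hk).ne'
  ext x y
  rw [Matrix.mul_apply]
  split_ifs with hkk
  · subst hkk
    simp only [typeProj]
    by_cases hx : occ x = k <;> by_cases hy : occ y = k <;> simp [hx, hy]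
    rw [← Finset.sum_filter,
      Finset.sum_congr rfl fun z hz => if_pos (Finset.mem_filter.mp hz).2, Finset.sum_const,
      nsmul_eq_mul]
    change ((words P k).card : ℂ) * _ = _
    field_simp
  · refine Finset.sum_eq_zero fun z _ => ?_
    simp only [typeProj]
    by_cases hz : occ z = k
    · have : occ z ≠ k' := hz ▸ hkk
      simp [this]
    · simp [hz]

theorem typeProj_isState {k : Fin d → ℕ} (hk : ∑ j, k j = Fintype.card P) :
    IsState (typeProj P k) := by
  have hc : ((words P k).card : ℂ) ≠ 0 := by exact_mod_cast (card_words_pos hk).ne'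
  constructor
  · rw [typeProj_eq_vecMulVec]
    exact Matrix.posSemidef_vecMulVec_self_star _
  · simp only [Matrix.trace, Matrix.diag_apply, typeProj, and_self]
    rw [← Finset.sum_filter, Finset.sum_const, nsmul_eq_mul]
    exact mul_inv_cancel₀ hc

/-- The eigenvalue is the probability that independent symbols with distribution `q` form a word of
type `k`. -/
theorem dephasedProduct_mul_typeProj {q : Fin d → ℝ} (hq : ∀ j, 0 ≤ q j) (k : Fin d → ℕ) :
    dephasedProduct P q * typeProj P k =
      ((words P k).card * ∏ j, q j ^ k j : ℝ) • typeProj P k := by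
  ext x z
  rw [Matrix.mul_apply, Matrix.smul_apply, Complex.real_smul]
  simp only [dephasedProduct, typeProj]
  by_cases hz : occ z = k <;> by_cases hx : occ x = k <;> simp only [hx, hz, and_self, and_true,
    and_false, if_true, if_false, mul_zero, Finset.sum_const_zero]
  · have h1 : ∀ y : P → Fin d, ((if k = occ y then ∏ l, ((√(q (x l)) : ℂ) * √(q (y l))) else 0) *
        if occ y = k then ((words P k).card : ℂ)⁻¹ else 0) =
        if occ y = k then ((∏ j, q j ^ k j : ℝ) : ℂ) * ((words P k).card : ℂ)⁻¹ else 0 := by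
      intro y
      by_cases hy : occ y = k
      · rw [if_pos hy.symm, if_pos hy, if_pos hy, Finset.prod_mul_distrib,
          prod_comp_eq_prod_pow_occ (fun j => (√(q j) : ℂ)),
          prod_comp_eq_prod_pow_occ (fun j => (√(q j) : ℂ)), hx, hy, ← Finset.prod_mul_distrib,
          Complex.ofReal_prod]
        congr 1
        refine Finset.prod_congr rfl fun j _ => ?_
        rw [← mul_pow, ← Complex.ofReal_mul, Real.mul_self_sqrt (hq j), Complex.ofReal_pow]
      · simp [hy]
    simp only [h1]
    rw [← Finset.sum_filter, Finset.sum_const, nsmul_eq_mul, Complex.ofReal_mul,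
      Complex.ofReal_natCast]
    change ((words P k).card : ℂ) * _ = _
    ring
  · refine Finset.sum_eq_zero fun y _ => ?_
    by_cases hy : occ y = k
    · simp [hy, hx]
    · simp [hy]

end Types

/-! ### The maximal overlap of a Dicke state with product states. -/

section DickeBound

/-- The likelihood of a type is maximized by its own frequencies. -/
theorem prod_pow_le_prod_div_pow {d N : ℕ} (hN : 0 < N) {k : Fin d → ℕ} (hk : ∑ j, k j = N)
    {p : Fin d → ℝ} (hp : ∀ j, 0 ≤ p j) (hp1 : ∑ j, p j ≤ 1) :
    ∏ j, p j ^ k j ≤ ∏ j, ((k j : ℝ) / N) ^ k j := by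
  have hN0 : (N : ℝ) ≠ 0 := by exact_mod_cast hN.ne'
  set q : Fin d → ℝ := fun j => (k j : ℝ) / N with hq
  have hq0 : ∀ j, 0 ≤ q j := fun j => by positivity
  have hq1 : ∑ j, q j = 1 := by
    rw [hq, ← Finset.sum_div, ← Nat.cast_sum, hk, div_self hN0]
  have hqk : ∀ j, 0 < q j ^ k j := fun j => by
    rcases Nat.eq_zero_or_pos (k j) with h | h
    · simp [h]
    · have : 0 < q j := by positivity
      positivity
  -- AM-GM for the ratios `p j / q j` with weights `q j`. Where `q j = 0` the ratio is 0 by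
  -- convention, and its exponent is 0 too.
  have h1 := Real.geom_mean_le_arith_mean_weighted Finset.univ q (fun j => p j / q j)
    (fun j _ => hq0 j) hq1 (fun j _ => div_nonneg (hp j) (hq0 j))
  have h2 : ∑ j, q j * (p j / q j) ≤ 1 := by
    refine le_trans (Finset.sum_le_sum fun j _ => ?_) hp1
    rcases (hq0 j).eq_or_lt with h | h
    · rw [← h, zero_mul]; exact hp j
    · exact (mul_div_cancel₀ _ h.ne').le
  have h0 : ∀ j, 0 ≤ p j / q j := fun j => div_nonneg (hp j) (hq0 j)
  have h3 : ∏ j, (p j / q j) ^ k j ≤ 1 := by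
    have h4 : ∏ j, (p j / q j) ^ k j = (∏ j, (p j / q j) ^ q j) ^ N := by
      rw [← Finset.prod_pow]
      refine Finset.prod_congr rfl fun j _ => ?_
      rw [← Real.rpow_natCast (_ ^ q j), ← Real.rpow_mul (h0 j), ← Real.rpow_natCast, hq,
        div_mul_cancel₀ _ hN0]
    rw [h4]
    exact pow_le_one₀ (Finset.prod_nonneg fun j _ => Real.rpow_nonneg (h0 j) _) (h1.trans h2)
  simp only [div_pow, Finset.prod_div_distrib] at h3
  rwa [div_le_one (Finset.prod_pos fun j _ => hqk j)] at h3

variable {P : Type} [Fintype P] [DecidableEq P] {d : ℕ}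

variable (P) in
/-- The multilinear form `∑_{x ∈ words k} ∏ₗ c l (x l)`. -/
def wordForm (k : Fin d → ℕ) : MultilinearMap ℝ (fun _ : P => Fin d → ℝ) ℝ :=
  ∑ x ∈ words P k, (MultilinearMap.mkPiAlgebra ℝ P ℝ).compLinearMap fun l => LinearMap.proj (x l)

theorem wordForm_apply (k : Fin d → ℕ) (c : P → Fin d → ℝ) :
    wordForm P k c = ∑ x ∈ words P k, ∏ l, c l (x l) := by
  simp [wordForm]

theorem wordForm_nonneg (k : Fin d → ℕ) {c : P → Fin d → ℝ} (hc : ∀ l j, 0 ≤ c l j) :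
    0 ≤ wordForm P k c := by
  rw [wordForm_apply]
  exact Finset.sum_nonneg fun x _ => Finset.prod_nonneg fun l _ => hc _ _

theorem wordForm_perm (k : Fin d → ℕ) (e : Equiv.Perm P) (c : P → Fin d → ℝ) :
    wordForm P k (fun l => c (e l)) = wordForm P k c := by
  rw [wordForm_apply, wordForm_apply]
  refine Finset.sum_bij' (fun x _ => x ∘ e.symm) (fun x _ => x ∘ e) ?_ ?_ ?_ ?_ ?_
  · intro x hx
    rw [mem_words] at hx ⊢
    rw [occ_comp_perm, hx]
  · intro x hx
    rw [mem_words] at hx ⊢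
    rw [occ_comp_perm, hx]
  · intro x _; ext; simp
  · intro x _; ext; simp
  · intro x _
    rw [← Equiv.prod_comp e fun l => c l ((x ∘ e.symm) l)]
    simp

/-- On the diagonal every word contributes `∏ j, u j ^ k j`, whose square is the likelihood of the
type under `p j = u j * u j`. Banach's theorem and homogeneity do the rest. -/
theorem wordForm_le {k : Fin d → ℕ} (hP : 0 < Fintype.card P) (hk : ∑ j, k j = Fintype.card P)
    {c : P → Fin d → ℝ} (hc : ∀ l j, 0 ≤ c l j) :
    wordForm P k c ≤ (words P k).card * √(∏ j, ((k j : ℝ) / Fintype.card P) ^ k j) *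
      ∏ l, √(c l ⬝ᵥ c l) := by
  have hcont : Continuous (wordForm P k) := by
    rw [show (wordForm P k : (P → Fin d → ℝ) → ℝ) = fun c => ∑ x ∈ words P k, ∏ l, c l (x l)
      from funext (wordForm_apply k)]
    fun_prop
  have hunit : ∀ c ∈ nonnegUnitFamilies P (Fin d), wordForm P k c ≤
      (words P k).card * √(∏ j, ((k j : ℝ) / Fintype.card P) ^ k j) := by
    intro c hc
    refine le_of_forall_diagonal_le hcont (fun c => wordForm_nonneg k) (wordForm_perm k) ?_ hc
    intro u hu hu1
    have h1 : ∀ x ∈ words P k, ∏ l, u (x l) = ∏ j, u j ^ k j := fun x hx => by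
      rw [prod_comp_eq_prod_pow_occ, mem_words.mp hx]
    rw [wordForm_apply, Finset.sum_congr rfl h1, Finset.sum_const, nsmul_eq_mul]
    refine mul_le_mul_of_nonneg_left (Real.le_sqrt_of_sq_le ?_) (Nat.cast_nonneg _)
    refine le_trans (le_of_eq ?_)
      (prod_pow_le_prod_div_pow hP hk (p := fun j => u j * u j) (fun j => mul_self_nonneg _) hu1)
    rw [← Finset.prod_pow]
    exact Finset.prod_congr rfl fun j _ => by rw [← sq, ← pow_mul, ← pow_mul, mul_comm]
  by_cases h0 : ∃ l, c l = 0
  · obtain ⟨l, hl⟩ := h0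
    rw [(wordForm P k).map_coord_zero l hl]
    positivity
  · push Not at h0
    have hpos : ∀ l, 0 < √(c l ⬝ᵥ c l) := fun l => Real.sqrt_pos.mpr (dotProduct_self_pos (h0 l))
    have hsq : ∀ l, √(c l ⬝ᵥ c l) * √(c l ⬝ᵥ c l) = c l ⬝ᵥ c l := fun l =>
      Real.mul_self_sqrt (dotProduct_self_pos (h0 l)).le
    have hsmul : c = fun l => √(c l ⬝ᵥ c l) • ((√(c l ⬝ᵥ c l))⁻¹ • c l) := by
      ext1 l
      rw [smul_smul, mul_inv_cancel₀ (hpos l).ne', one_smul]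
    conv_lhs => rw [hsmul]
    rw [(wordForm P k).map_smul_univ, smul_eq_mul, mul_comm]
    refine mul_le_mul_of_nonneg_right (hunit _ ⟨fun l j => ?_, fun l => ?_⟩)
      (Finset.prod_nonneg fun l _ => (hpos l).le)
    · exact mul_nonneg (inv_nonneg.mpr (hpos l).le) (hc l j)
    · rw [smul_dotProduct, dotProduct_smul, smul_eq_mul, smul_eq_mul]
      conv_lhs => enter [2, 2]; rw [← hsq]
      rw [inv_mul_cancel_left₀ (hpos l).ne', inv_mul_cancel₀ (hpos l).ne']

theorem dotProduct_vecMulVec_mulVec {n : Type} [Fintype n] (ψ v : n → ℂ) :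
    (star v ⬝ᵥ Matrix.vecMulVec ψ (star ψ) *ᵥ v).re = ‖star ψ ⬝ᵥ v‖ ^ 2 := by
  rw [Matrix.vecMulVec_mulVec, op_smul_eq_smul, dotProduct_smul, smul_eq_mul,
    Matrix.star_dotProduct, Complex.star_def, Complex.conj_mul', ← Complex.ofReal_pow,
    Complex.ofReal_re, RCLike.norm_conj]

theorem productBound_typeProj {k : Fin d → ℕ} (hP : 0 < Fintype.card P)
    (hk : ∑ j, k j = Fintype.card P) :
    ProductBound (typeProj P k)
      ((words P k).card * ∏ j, ((k j : ℝ) / Fintype.card P) ^ k j) := by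
  intro a
  rw [typeProj_eq_vecMulVec, dotProduct_vecMulVec_mulVec]
  set M : ℝ := ((words P k).card : ℝ) with hM
  set Q : ℝ := ∏ j, ((k j : ℝ) / Fintype.card P) ^ k j with hQ
  have hM0 : 0 < M := Nat.cast_pos.mpr (card_words_pos hk)
  have hQ0 : 0 ≤ Q := Finset.prod_nonneg fun j _ => by positivity
  set r : P → ℝ := fun l => ∑ j, ‖a l j‖ ^ 2 with hr
  have hr0 : ∀ l, 0 ≤ r l := fun l => Finset.sum_nonneg fun _ _ => by positivity
  have hc : ∀ l, (fun j => ‖a l j‖) ⬝ᵥ (fun j => ‖a l j‖) = r l := fun l => by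
    simp [dotProduct, hr, sq]
  have h1 := wordForm_le hP hk (c := fun l j => ‖a l j‖) fun l j => norm_nonneg _
  simp only [hc, ← hM, ← hQ] at h1
  have h2 : ‖(star fun x : P → Fin d => if occ x = k then ((1 / √M : ℝ) : ℂ) else 0) ⬝ᵥ
      prodVec a‖ ≤ 1 / √M * wordForm P k fun l j => ‖a l j‖ := by
    rw [wordForm_apply, Finset.mul_sum, dotProduct]
    refine (norm_sum_le _ _).trans ?_
    rw [words, Finset.sum_filter]
    refine Finset.sum_le_sum fun x _ => le_of_eq ?_
    rw [norm_mul, Pi.star_apply, norm_star, prodVec, norm_prod]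
    split_ifs
    · rw [Complex.norm_real, Real.norm_of_nonneg (by positivity)]
    · simp
  calc _ ≤ (1 / √M * (M * √Q * ∏ l, √(r l))) ^ 2 := by
        gcongr
        exact h2.trans (mul_le_mul_of_nonneg_left h1 (by positivity))
    _ = M * Q * ∏ l, r l := by
        rw [mul_pow, mul_pow, mul_pow, div_pow, Real.sq_sqrt hM0.le, Real.sq_sqrt hQ0,
          ← Finset.prod_pow, Finset.prod_congr rfl fun l _ => Real.sq_sqrt (hr0 l)]
        field_simp

theorem typeProj_overlapCertificate {k : Fin d → ℕ} (hP : 0 < Fintype.card P)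
    (hk : ∑ j, k j = Fintype.card P) :
    OverlapCertificate (typeProj P k) (dephasedProduct P fun j => (k j : ℝ) / Fintype.card P)
      ((words P k).card * ∏ j, ((k j : ℝ) / Fintype.card P) ^ k j) where
  isState := typeProj_isState hk
  entry_nonneg := typeProj_entry_nonneg k
  bound := productBound_typeProj hP hk
  mem_SEP := dephasedProduct_mem_SEP (fun j => by positivity) (by
    rw [← Finset.sum_div, ← Nat.cast_sum, hk, div_self (by exact_mod_cast hP.ne')])
  mul_eq := dephasedProduct_mul_typeProj (fun j => by positivity) k
  pos := by
    refine mul_pos (by exact_mod_cast card_words_pos hk) (Finset.prod_pos fun j _ => ?_)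
    rcases Nat.eq_zero_or_pos (k j) with h | h
    · simp [h]
    · positivity

theorem typeProj_spectralResolution {k : Fin d → ℕ} (hk : ∑ j, k j = Fintype.card P) :
    SpectralResolution (typeProj P k) (fun _ : Unit => (1 : ℝ)) (fun _ => typeProj P k) where
  sum_eq := by simp
  trace_eq _ := (typeProj_isState hk).2
  mul_eq _ := by rw [typeProj_mul _ _ hk, if_pos rfl, one_smul]

end DickeBound

/-! ### Tracing out one party. -/

section Reduced

variable {P : Type} [Fintype P] [DecidableEq P]

theorem ProductBound.reduced {ι : P → Type} [∀ l, Fintype (ι l)] {ψ : (∀ l, ι l) → ℂ} {c : ℝ}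
    (hc : 0 ≤ c) (h : ProductBound (Matrix.vecMulVec ψ (star ψ)) c) (i : P) :
    ProductBound (reduced i (Matrix.vecMulVec ψ (star ψ))) c := by
  intro a
  set β : ι i → ℂ := fun s =>
    star (fun x => ψ ((Equiv.piSplitAt i ι).symm (s, x))) ⬝ᵥ prodVec a with hβ
  set R : ℝ := ∑ s, ‖β s‖ ^ 2 with hR
  have hR0 : 0 ≤ R := Finset.sum_nonneg fun _ _ => by positivity
  set A : ℝ := ∏ l : {l // l ≠ i}, ∑ j, ‖a l j‖ ^ 2 with hA
  have hA0 : 0 ≤ A := Finset.prod_nonneg fun _ _ => Finset.sum_nonneg fun _ _ => by positivity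
  have h1 : (star (prodVec a) ⬝ᵥ MultipartiteEntanglement.reduced i
      (Matrix.vecMulVec ψ (star ψ)) *ᵥ prodVec a).re = R := by
    have h2 : MultipartiteEntanglement.reduced i (Matrix.vecMulVec ψ (star ψ)) =
        ∑ s, Matrix.vecMulVec (fun x => ψ ((Equiv.piSplitAt i ι).symm (s, x)))
          (star fun x => ψ ((Equiv.piSplitAt i ι).symm (s, x))) := by
      ext x y
      rw [Matrix.sum_apply]
      rfl
    rw [h2, Matrix.sum_mulVec, dotProduct_sum, Complex.re_sum]
    exact Finset.sum_congr rfl fun s _ => dotProduct_vecMulVec_mulVec _ _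
  rw [h1]
  -- The vector at the traced-out party is chosen to align with the partial contraction `β`. The
  -- overlap of `ψ` with `b` is then `R`, so the bound reads `R ^ 2 ≤ c * (R * A)`, whence `R ≤ c *
  -- A`.
  set b : ∀ l, ι l → ℂ := (Equiv.piSplitAt i fun l => ι l → ℂ).symm (star β, a) with hb
  have hbi : b i = star β := by simp [hb]
  have hbl : ∀ l : {l // l ≠ i}, b l = a l := fun l => by simp [hb, l.2]
  have hsplit : ∀ s x, prodVec b ((Equiv.piSplitAt i ι).symm (s, x)) =
      star (β s) * prodVec a x := by
    intro s x
    rw [prodVec, Fintype.prod_eq_mul_prod_subtype_ne _ i, hbi]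
    simp only [hbl]
    congr 1
    · simp
    · exact Finset.prod_congr rfl fun l _ => by simp [l.2]
  have h3 : star ψ ⬝ᵥ prodVec b = R := by
    rw [dotProduct, ← (Equiv.piSplitAt i ι).symm.sum_comp, Fintype.sum_prod_type, hR,
      Complex.ofReal_sum]
    refine Finset.sum_congr rfl fun s _ => ?_
    simp only [hsplit]
    rw [Complex.ofReal_pow, ← Complex.conj_mul', ← Complex.star_def]
    conv_rhs => rw [hβ]; enter [2]; simp only [dotProduct]
    rw [Finset.mul_sum]
    exact Finset.sum_congr rfl fun x _ => by simp only [Pi.star_apply]; ring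
  have h4 := h b
  rw [dotProduct_vecMulVec_mulVec, h3, Fintype.prod_eq_mul_prod_subtype_ne _ i, hbi] at h4
  simp only [hbl, Pi.star_apply, norm_star] at h4
  rw [← hR, ← hA, Complex.norm_real, Real.norm_of_nonneg hR0] at h4
  rcases hR0.eq_or_lt with h0 | h0
  · rw [← h0]; positivity
  · nlinarith

variable {d : ℕ}

theorem occ_piSplitAt_symm (i : P) (s : Fin d) (x : {l : P // l ≠ i} → Fin d) (j : Fin d) :
    occ ((Equiv.piSplitAt i fun _ => Fin d).symm (s, x)) j =
      occ x j + if s = j then 1 else 0 := by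
  simp only [occ, Finset.card_filter]
  rw [Fintype.sum_eq_add_sum_subtype_ne _ i, add_comm]
  congr 1
  · exact Finset.sum_congr rfl fun l _ => by simp [l.2]
  · simp

/-- The condition `k s ≠ 0` is needed because subtraction of naturals truncates at zero. -/
theorem occ_piSplitAt_symm_eq_iff (i : P) (s : Fin d) (x : {l : P // l ≠ i} → Fin d)
    (k : Fin d → ℕ) : occ ((Equiv.piSplitAt i fun _ => Fin d).symm (s, x)) = k ↔
      k s ≠ 0 ∧ occ x = k - Pi.single s 1 := by
  simp only [funext_iff, occ_piSplitAt_symm, Pi.sub_apply, Pi.single_apply]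
  constructor
  · intro h
    refine ⟨fun h0 => ?_, fun j => ?_⟩
    · have := h s
      simp [h0] at this
    · have := h j
      split_ifs at this ⊢ with h1 h2 h2 <;> omega
  · rintro ⟨h0, h⟩ j
    have := h j
    rcases eq_or_ne s j with rfl | hj
    · simp at this ⊢; omega
    · simp [hj, hj.symm] at this ⊢; omega

theorem sum_sub_single {k : Fin d → ℕ} {s : Fin d} (hs : k s ≠ 0) :
    ∑ j, (k - Pi.single s 1 : Fin d → ℕ) j + 1 = ∑ j, k j := by
  have h : ∀ j, k j = (k - Pi.single s 1 : Fin d → ℕ) j + (Pi.single s 1 : Fin d → ℕ) j := by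
    intro j
    rcases eq_or_ne j s with rfl | hj
    · simp; omega
    · simp [hj]
  conv_rhs => rw [Finset.sum_congr rfl fun j _ => h j]
  rw [Finset.sum_add_distrib, Fintype.sum_pi_single']

theorem prod_pow_sub_single {k : Fin d → ℕ} {s : Fin d} (hs : k s ≠ 0) (q : Fin d → ℝ) :
    q s * ∏ j, q j ^ (k - Pi.single s 1 : Fin d → ℕ) j = ∏ j, q j ^ k j := by
  rw [← Finset.mul_prod_erase _ _ (Finset.mem_univ s),
    ← Finset.mul_prod_erase _ (fun j => q j ^ k j) (Finset.mem_univ s), ← mul_assoc, ← pow_succ']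
  congr 1
  · congr 1
    simp; omega
  · exact Finset.prod_congr rfl fun j hj => by simp [Finset.ne_of_mem_erase hj]

theorem card_words_sub_single (i : P) {k : Fin d → ℕ} (hk : ∑ j, k j = Fintype.card P) {s : Fin d}
    (hs : k s ≠ 0) :
    ((words {l : P // l ≠ i} (k - Pi.single s 1)).card : ℝ) =
      (words P k).card * (k s / Fintype.card P) := by
  have hcard : Fintype.card {l : P // l ≠ i} + 1 = Fintype.card P := by
    have := Fintype.card_pos_iff.mpr ⟨i⟩
    rw [Fintype.card_subtype_compl, Fintype.card_subtype_eq]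
    omega
  have hsum := sum_sub_single hs
  have h1 := card_words_mul hk
  have h2 := card_words_mul (P := {l : P // l ≠ i}) (k := k - Pi.single s 1) (by omega)
  set k' : Fin d → ℕ := k - Pi.single s 1 with hk'
  have h3 : ∏ j, (k j)! = k s * ∏ j, (k' j)! := by
    rw [← Finset.mul_prod_erase _ _ (Finset.mem_univ s),
      ← Finset.mul_prod_erase _ (fun j => (k' j)!) (Finset.mem_univ s), ← mul_assoc, hk']
    congr 1
    · simp [Nat.mul_factorial_pred hs]
    · exact Finset.prod_congr rfl fun j hj => by simp [Finset.ne_of_mem_erase hj]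
  rw [h3, ← hcard, Nat.factorial_succ, ← h2] at h1
  have h4 : 0 < ∏ j, (k' j)! := Finset.prod_pos fun j _ => Nat.factorial_pos _
  have h5 : k s * (words P k).card = (Fintype.card {l : P // l ≠ i} + 1) *
      (words {l : P // l ≠ i} k').card := by
    refine Nat.eq_of_mul_eq_mul_left h4 ?_
    linarith
  rw [hcard] at h5
  have h6 : (Fintype.card P : ℝ) ≠ 0 := by rw [← hcard]; positivity
  have h7 : (k s : ℝ) * (words P k).card = Fintype.card P *
      (words {l : P // l ≠ i} k').card := by exact_mod_cast h5
  field_simp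
  linarith

/-- Conditioning on the symbol `s` of the removed party leaves the Dicke state with one `s` fewer,
with probability `k s / N`. Different `s` give different types, hence orthogonal states; restricting
to `k s ≠ 0` keeps the weights positive. -/
theorem reduced_typeProj_spectralResolution (i : P) {k : Fin d → ℕ}
    (hk : ∑ j, k j = Fintype.card P) :
    SpectralResolution (n := {l : P // l ≠ i} → Fin d) (reduced i (typeProj P k))
      (fun s : {s // k s ≠ 0} => (k s : ℝ) / Fintype.card P)
      (fun s => typeProj {l : P // l ≠ i} (k - Pi.single s.1 1)) := by
  have hcard : Fintype.card {l : P // l ≠ i} + 1 = Fintype.card P := by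
    have := Fintype.card_pos_iff.mpr ⟨i⟩
    rw [Fintype.card_subtype_compl, Fintype.card_subtype_eq]
    omega
  have hks : ∀ s : {s // k s ≠ 0}, ∑ j, (k - Pi.single s.1 1 : Fin d → ℕ) j =
      Fintype.card {l : P // l ≠ i} := fun s => by
    have := sum_sub_single s.2
    omega
  have hsum : @Eq (Op fun _ : {l : P // l ≠ i} => Fin d) (reduced i (typeProj P k))
      (∑ s : {s // k s ≠ 0}, ((k s : ℝ) / Fintype.card P) •
        typeProj {l : P // l ≠ i} (k - Pi.single s.1 1)) := by
    have hsub : ∀ f : Fin d → ℂ, ∑ s : {s // k s ≠ 0}, f s = ∑ s, if k s ≠ 0 then f s else 0 :=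
      fun f => by
        rw [← Finset.sum_filter]
        exact (Finset.sum_subtype _ (by simp) f).symm
    ext x y
    rw [Matrix.sum_apply]
    have hsub' := hsub fun s => (((k s : ℝ) / Fintype.card P : ℝ) : ℂ) *
      typeProj {l : P // l ≠ i} (k - Pi.single s 1) x y
    refine (Eq.trans ?_ hsub'.symm).trans
      (Finset.sum_congr rfl fun s _ => Complex.real_smul.symm)
    rw [reduced]
    refine Finset.sum_congr rfl fun s _ => ?_
    simp only [typeProj, occ_piSplitAt_symm_eq_iff]
    by_cases hs : k s = 0
    · simp [hs]
    · simp only [hs, ne_eq, not_false_eq_true, true_and, if_true]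
      have h1 := card_words_sub_single i hk hs
      have h2 := card_words_pos (hks ⟨s, hs⟩)
      have h3 := card_words_pos hk
      split_ifs
      · rw [← Complex.ofReal_natCast, ← Complex.ofReal_natCast,
          ← Complex.ofReal_inv, ← Complex.ofReal_inv, ← Complex.ofReal_mul]
        congr 1
        have h4 : ((words {l : P // l ≠ i} (k - Pi.single s 1)).card : ℝ) ≠ 0 := by
          exact_mod_cast h2.ne'
        have h5 : ((words P k).card : ℝ) ≠ 0 := by exact_mod_cast h3.ne'
        rw [eq_mul_inv_iff_mul_eq₀ h4, h1]
        field_simp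
      · simp
  refine ⟨hsum, fun s => (typeProj_isState (hks s)).2, fun s => ?_⟩
  rw [hsum, Matrix.sum_mul, Finset.sum_eq_single s]
  · rw [Matrix.smul_mul, typeProj_mul _ _ (hks s), if_pos rfl]
  · intro t _ hts
    rw [Matrix.smul_mul, typeProj_mul _ _ (hks t), if_neg, smul_zero]
    intro h
    have := congrFun h t.1
    have hne : t.1 ≠ s.1 := fun h => hts (Subtype.ext h)
    have := t.2
    simp [hne] at *
    omega
  · simp

end Reduced

/-! ### The certificate of the reduced state. -/

section ReducedCertificate

variable {P : Type} [Fintype P] [DecidableEq P] {d : ℕ}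

/-- The frequencies stay `k j / N` although a party is missing. On the component with one `s` fewer,
the factor `k s / N` lost from the product is regained from the number of words, so the eigenvalue
is the same `c` for every `s`. -/
theorem reduced_typeProj_overlapCertificate (i : P) {k : Fin d → ℕ}
    (hk : ∑ j, k j = Fintype.card P) :
    OverlapCertificate (ι := fun _ : {l : P // l ≠ i} => Fin d) (reduced i (typeProj P k))
      (dephasedProduct {l : P // l ≠ i} fun j => (k j : ℝ) / Fintype.card P)
      ((words P k).card * ∏ j, ((k j : ℝ) / Fintype.card P) ^ k j) := by
  have hP : 0 < Fintype.card P := Fintype.card_pos_iff.mpr ⟨i⟩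
  have hP0 : (Fintype.card P : ℝ) ≠ 0 := by exact_mod_cast hP.ne'
  have hcert := typeProj_overlapCertificate hP hk
  have hres := reduced_typeProj_spectralResolution i hk
  have hcard : Fintype.card {l : P // l ≠ i} + 1 = Fintype.card P := by
    rw [Fintype.card_subtype_compl, Fintype.card_subtype_eq]
    omega
  have hks : ∀ s : {s // k s ≠ 0}, ∑ j, (k - Pi.single s.1 1 : Fin d → ℕ) j =
      Fintype.card {l : P // l ≠ i} := fun s => by
    have := sum_sub_single s.2
    omega
  have hq1 : ∑ j, (k j : ℝ) / Fintype.card P = 1 := by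
    rw [← Finset.sum_div, ← Nat.cast_sum, hk, div_self hP0]
  refine ⟨⟨?_, ?_⟩, fun x y => Finset.sum_nonneg fun _ _ => hcert.entry_nonneg _ _, ?_,
    dephasedProduct_mem_SEP (fun j => by positivity) hq1, ?_, hcert.pos⟩
  · rw [hres.sum_eq]
    exact Matrix.posSemidef_sum _ fun s _ =>
      real_smul_posSemidef (typeProj_isState (hks s)).1 (by positivity)
  · rw [← hcert.isState.2, Matrix.trace, Matrix.trace,
      ← (Equiv.piSplitAt i fun _ => Fin d).symm.sum_comp, Fintype.sum_prod_type, Finset.sum_comm]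
    rfl
  · have h := hcert.bound
    rw [typeProj_eq_vecMulVec] at h ⊢
    exact h.reduced hcert.pos.le i
  · rw [hres.sum_eq, Matrix.mul_sum, Finset.smul_sum]
    refine Finset.sum_congr rfl fun s _ => ?_
    rw [Matrix.mul_smul, dephasedProduct_mul_typeProj fun j => by positivity,
      card_words_sub_single i hk s.2, mul_assoc,
      prod_pow_sub_single s.2 fun j => (k j : ℝ) / Fintype.card P, smul_comm]

theorem sum_subtype_mul_logb (k : Fin d → ℕ) (N : ℕ) :
    ∑ s : {s // k s ≠ 0}, (k s : ℝ) / N * Real.logb 2 ((k s : ℝ) / N) =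
      -shannonEntropy fun j => (k j : ℝ) / N := by
  rw [shannonEntropy, neg_neg, ← Finset.sum_subtype (Finset.univ.filter fun s => k s ≠ 0) (by simp)
    fun s => (k s : ℝ) / N * Real.logb 2 ((k s : ℝ) / N), Finset.sum_filter]
  refine Finset.sum_congr rfl fun s _ => ?_
  split_ifs with h
  · rfl
  · simp [not_not.mp h]

end ReducedCertificate

/-! ### Identification with the Dicke states of the statement. -/

section Dicke

variable {N d : ℕ} {k : Fin d → ℕ}

theorem card_words_fin (hk : ∑ j, k j = N) :
    ((words (Fin N) k).card : ℝ) = (N ! : ℝ) / ∏ j, ((k j)! : ℝ) := by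
  have h := card_words_mul (P := Fin N) (k := k) (by rw [hk, Fintype.card_fin])
  rw [Fintype.card_fin] at h
  rw [← h, eq_div_iff (by positivity)]
  push_cast
  ring

theorem dicke_eq_typeProj (hk : ∑ j, k j = N) : dicke N k = typeProj (Fin N) k := by
  have h : dickeVec N k = fun x => if occ x = k then
      ((1 / √((words (Fin N) k).card : ℝ) : ℝ) : ℂ) else 0 := by
    ext x
    rw [dickeVec, card_words_fin hk]
    simp only [funext_iff, occ]
  rw [typeProj_eq_vecMulVec, dicke, h]

theorem dickeValue_eq (hk : ∑ j, k j = N) : dickeValue N k =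
    -Real.logb 2 ((words (Fin N) k).card * ∏ j, ((k j : ℝ) / Fintype.card (Fin N)) ^ k j) := by
  rw [dickeValue, card_words_fin hk, Fintype.card_fin]

end Dicke

end MultipartiteEntanglement

end

open MultipartiteEntanglement
theorem mainTheorem9 (N d : ℕ) (hN : 1 ≤ N) (k : Fin d → ℕ) (hk : ∑ j, k j = N) :
    -- additivity of the three measures of the generalized Dicke state
    (IsStrongAdditive GM (dicke N k) ∧ IsAdditive REE (dicke N k) ∧ IsAdditive LGR (dicke N k)) ∧
    -- the three asymptotic measures
    (HasAsymptotic LGR (dicke N k) (dickeValue N k) ∧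
      HasAsymptotic REE (dicke N k) ((dickeValue N k : ℝ) : EReal) ∧
      HasAsymptotic GM (dicke N k) (dickeValue N k)) ∧
    -- the reduced states, whichever party is traced out
    (∀ i : Fin N,
      IsAdditive REE (reduced i (dicke N k)) ∧
      REE (fun _ : {l : Fin N // l ≠ i} => Fin d) (reduced i (dicke N k)) =
        ((dickeValue N k - shannonEntropy (fun j => (k j : ℝ) / (N : ℝ)) : ℝ) : EReal) ∧
      HasAsymptotic REE (reduced i (dicke N k))
        ((dickeValue N k - shannonEntropy (fun j => (k j : ℝ) / (N : ℝ)) : ℝ) : EReal)) := by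
  have hkP : ∑ j, k j = Fintype.card (Fin N) := by rw [hk, Fintype.card_fin]
  have hP : 0 < Fintype.card (Fin N) := by rw [Fintype.card_fin]; exact hN
  have hcert := typeProj_overlapCertificate hP hkP
  have hres := typeProj_spectralResolution (P := Fin N) hkP
  have hidem : typeProj (Fin N) k * typeProj (Fin N) k = typeProj (Fin N) k := by
    rw [typeProj_mul _ _ hkP, if_pos rfl]
  rw [dicke_eq_typeProj hk, dickeValue_eq hk]
  have hREE := hcert.REE_eq_of_spectralResolution hres
  have hREE' := hcert.hasAsymptotic_REE hres fun _ => one_pos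
  -- A pure state has the single spectral weight 1, so its entropy term vanishes.
  simp only [Finset.univ_unique, Real.logb_one, mul_zero, Finset.sum_const_zero, zero_sub]
    at hREE hREE'
  refine ⟨⟨hcert.GM_isStrongAdditive, ?_, ?_⟩, ⟨hcert.hasAsymptotic_LGR hidem, hREE',
    hcert.hasAsymptotic_GM⟩, fun i => ?_⟩
  · rw [IsAdditive, hREE]
    exact hREE'
  · rw [IsAdditive, hcert.LGR_eq hidem]
    exact hcert.hasAsymptotic_LGR hidem
  · have hcert' := reduced_typeProj_overlapCertificate i hkP
    have hres' := reduced_typeProj_spectralResolution i hkP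
    have h1 := hcert'.REE_eq_of_spectralResolution hres'
    have h2 := hcert'.hasAsymptotic_REE hres' fun s =>
      div_pos (Nat.cast_pos.mpr (Nat.pos_of_ne_zero s.2)) (Nat.cast_pos.mpr hP)
    rw [sum_subtype_mul_logb, neg_sub_comm] at h1 h2
    simp only [Fintype.card_fin] at h1 h2 ⊢
    refine ⟨?_, h1, h2⟩
    rw [IsAdditive, h1]
    exact h2
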